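/- An operator sequence space is a complex vector space $X$ with a norm $\|\cdot\|_n$ on each $X^n$ ($n\ge 1$) such that $\|\alpha x\|_m\le\|\alpha\|\,\|x\|_n$ for $x\in X^n$ and $\alpha\in M_{m,n}(\mathbb C)$ (operator norm $\ell_2^n\to\ell_2^m$) and $\|(x,y)\|_{n+m}^2\le\|x\|_n^2+\|y\|_m^2$ for $x\in X^n$, $y\in X^m$. It is Banach if $(X,\|\cdot\|_1)$ is complete. A linear map $\varphi$ is sequentially isometric if $\|(\varphi(x_i))_i\|_n=\|x\|_n$ for all $n$ and $x\in X^n$. A Hilbert space $H$ carries the norms $\|x\|_n=(\sum_i\|x_i\|^2)^{1/2}$. The sequential dual $Z^\triangle$ is the space of sequentially bounded functionals on $Z$ (those with $\sup_k\|f^{(k)}:Z^k\to\ell_2^k\|<\infty$, where $f^{(k)}(z)=(f(z_j))_j$), and $\|(f_1,\dots,f_n)\|_n$ is the least $C\ge 0$ with $(\sum_{i,j}|f_i(z_j)|^2)^{1/2}\le C\|z\|_k$ for all $k$ and $z\in Z^k$; the weak* topology of $Z^\triangle$ is that of pointwise convergence on $Z$. The sum $\bigoplus_\infty\{X_\lambda\}$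 consists of the bounded families, with $\|x\|_n=\sup_\lambda\|x_\lambda\|_n$, and $l_2^\infty=\bigoplus_\infty\{\ell_2^n:n\ge1\}$. The space $X$ is a dual operator sequence space if there are an operator sequence space $Z$ (a predual) and a sequentially isometric linear isomorphism $j:X\to Z^\triangle$; the weak* topology of $X$ for $(Z,j)$ is the one that $j$ transports from $Z^\triangle$. For a set $\Lambda$ put $L_\Lambda=\bigoplus_\infty\{l_2^\infty:\lambda\in\Lambda\}$. Its weak* topology, as the dual of $\bigoplus_1^0\{t_2^\infty:\lambda\in\Lambda\}$, is the weakest topology for which $y\mapsto\langle a,y\rangle=\sum_{\lambda,n}\sum_{i\le n}a_{\lambda,n,i}\,y_{\lambda,n,i}$ is continuous for every family $a=(a_{\lambda,n})$, $a_{\lambda,n}\in\mathbb C^n$, with finitely many nonzero members. Proposition. Let $X$ be an operator sequence space. (1) $X$ is a dual operator sequence space if and only if for some set $\Lambda$ there is a sequentially isometric linear map $\varphi:X\to L_\Lambda$ with weak*-closed range. (2) More precisely, a topology $\tau$ on $X$ is the weak* topology of $X$ for some predual $(Z,j)$ if and only if for some set $\Lambda$ there is a sequentially isometric linear map $\varphi:X\to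 L_\Lambda$ whose range is weak*-closed and which is a homeomorphism of $(X,\tau)$ onto its range with the weak* topology. (3) Statements (1) and (2) remain true if only Banach preduals $Z$ are admitted and the weak* topology of $L_\Lambda$ is the one given by its Banach predual, i.e. by the functionals $\langle a,\cdot\rangle$ for all families $a$ with $\sum_{\lambda,n}\|a_{\lambda,n}\|_2<\infty$. -/

import Mathlib

universe u v w

namespace OpSeq

open scoped Matrix.Norms.L2Operator in
/-- An operator sequence space: a complex vector space `E` with a norm on every `Eⁿ` such that
`‖α x‖ ≤ ‖α‖ ‖x‖` for scalar matrices `α` (with the operator norm of `ℓ₂ⁿ → ℓ₂ᵐ`) and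
`‖(x, y)‖² ≤ ‖x‖² + ‖y‖²`. The case `n = 0` is harmless: `E⁰` is the zero space. -/
class OperatorSequenceSpace (E : Type u) [AddCommGroup E] [Module ℂ E] where
  seqNorm : ∀ n : ℕ, Seminorm ℂ (Fin n → E)
  eq_zero_of_seqNorm : ∀ (n : ℕ) (x : Fin n → E), seqNorm n x = 0 → x = 0
  seqNorm_matrix : ∀ (m n : ℕ) (α : Matrix (Fin m) (Fin n) ℂ) (x : Fin n → E),
    seqNorm m (fun i => ∑ j, α i j • x j) ≤ ‖α‖ * seqNorm n x
  seqNorm_append : ∀ (m n : ℕ) (x : Fin n → E) (y : Fin m → E),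
    seqNorm (n + m) (Fin.append x y) ^ 2 ≤ seqNorm n x ^ 2 + seqNorm m y ^ 2

/-- The norm of the first amplification, i.e. of the underlying normed space. -/
noncomputable def norm1 {E : Type u} [AddCommGroup E] [Module ℂ E] [OperatorSequenceSpace E]
    (x : E) : ℝ :=
  OperatorSequenceSpace.seqNorm 1 (fun _ => x)

/-- The underlying normed space is complete. -/
def IsBanach (E : Type u) [AddCommGroup E] [Module ℂ E] [OperatorSequenceSpace E] : Prop :=
  ∀ s : ℕ → E, (∀ ε > 0, ∃ N, ∀ m ≥ N, ∀ n ≥ N, norm1 (s m - s n) < ε) →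
    ∃ x : E, ∀ ε > 0, ∃ N, ∀ n ≥ N, norm1 (s n - x) < ε

section Maps

variable {X : Type u} {Y : Type v} [AddCommGroup X] [Module ℂ X] [OperatorSequenceSpace X]
  [AddCommGroup Y] [Module ℂ Y] [OperatorSequenceSpace Y]

/-- The constants `C ≥ 0` that bound all amplifications of `φ`. -/
def seqBounds (φ : X →ₗ[ℂ] Y) : Set ℝ :=
  {C | 0 ≤ C ∧ ∀ (n : ℕ) (x : Fin n → X),
    OperatorSequenceSpace.seqNorm n (fun i => φ (x i)) ≤ C * OperatorSequenceSpace.seqNorm n x}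

/-- Sequentially bounded operators. -/
def IsSeqBounded (φ : X →ₗ[ℂ] Y) : Prop := (seqBounds φ).Nonempty

/-- `‖φ‖_sb`, the supremum of the norms of the amplifications, as their least common bound. -/
noncomputable def sbNorm (φ : X →ₗ[ℂ] Y) : ℝ := sInf (seqBounds φ)

/-- Sequentially isometric operators: every amplification is isometric. -/
def SeqIsometric (φ : X →ₗ[ℂ] Y) : Prop :=
  ∀ (n : ℕ) (x : Fin n → X),
    OperatorSequenceSpace.seqNorm n (fun i => φ (x i)) = OperatorSequenceSpace.seqNorm n x

theorem sbNorm_nonneg (φ : X →ₗ[ℂ] Y) : 0 ≤ sbNorm φ :=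
  Real.sInf_nonneg fun _ h => h.1

theorem sbNorm_le {φ : X →ₗ[ℂ] Y} {C : ℝ} (h : C ∈ seqBounds φ) : sbNorm φ ≤ C :=
  csInf_le ⟨0, fun _ h => h.1⟩ h

theorem sbNorm_mem {φ : X →ₗ[ℂ] Y} (h : IsSeqBounded φ) : sbNorm φ ∈ seqBounds φ := by
  refine ⟨sbNorm_nonneg φ, fun n x => ?_⟩
  have hx : 0 ≤ OperatorSequenceSpace.seqNorm n x := apply_nonneg _ _
  rcases hx.eq_or_lt with h0 | h0
  · obtain ⟨C, hC⟩ := h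
    have := hC.2 n x
    rw [← h0] at this ⊢
    simpa using this
  · rw [← div_le_iff₀ h0]
    exact le_csInf h fun C hC => by rw [div_le_iff₀ h0]; exact hC.2 n x

end Maps

section Hilbert

/-- The standard operator sequence space structure of a Hilbert space: `Hⁿ` carries the norm of
the Hilbert sum of `n` copies of `H`. In particular `ℂⁿ` carries the norm of `ℓ₂ⁿ`. -/
noncomputable def hilbertSeminorm (H : Type u) [NormedAddCommGroup H] [InnerProductSpace ℂ H]
    (n : ℕ) : Seminorm ℂ (Fin n → H) :=
  Seminorm.of (fun x => Real.sqrt (∑ i, ‖x i‖ ^ 2))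
    (fun x y => by
      have := norm_add_le (WithLp.toLp 2 x : PiLp 2 fun _ : Fin n => H) (WithLp.toLp 2 y)
      simpa [PiLp.norm_eq_of_L2] using this)
    (fun a x => by
      have := norm_smul a (WithLp.toLp 2 x : PiLp 2 fun _ : Fin n => H)
      simpa [PiLp.norm_eq_of_L2] using this)

theorem hilbertSeminorm_apply {H : Type u} [NormedAddCommGroup H] [InnerProductSpace ℂ H]
    {n : ℕ} (x : Fin n → H) : hilbertSeminorm H n x = Real.sqrt (∑ i, ‖x i‖ ^ 2) := rfl

theorem hilbertSeminorm_sq {H : Type u} [NormedAddCommGroup H] [InnerProductSpace ℂ H]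
    {n : ℕ} (x : Fin n → H) : hilbertSeminorm H n x ^ 2 = ∑ i, ‖x i‖ ^ 2 := by
  rw [hilbertSeminorm_apply, Real.sq_sqrt (by positivity)]

open scoped Matrix.Norms.L2Operator in
theorem sum_matrix_le {m n : ℕ} (α : Matrix (Fin m) (Fin n) ℂ) (z : Fin n → ℂ) :
    ∑ i, ‖∑ j, α i j * z j‖ ^ 2 ≤ ‖α‖ ^ 2 * ∑ j, ‖z j‖ ^ 2 := by
  have := Matrix.l2_opNorm_mulVec α (WithLp.toLp 2 z)
  have h2 := pow_le_pow_left₀ (norm_nonneg _) this 2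
  rw [mul_pow, EuclideanSpace.norm_sq_eq, EuclideanSpace.norm_sq_eq] at h2
  simpa [Matrix.mulVec, dotProduct] using h2

open scoped Matrix.Norms.L2Operator in
theorem sum_matrix_le' {H : Type u} [NormedAddCommGroup H] [InnerProductSpace ℂ H] {m n : ℕ}
    (α : Matrix (Fin m) (Fin n) ℂ) (x : Fin n → H) :
    ∑ i, ‖∑ j, α i j • x j‖ ^ 2 ≤ ‖α‖ ^ 2 * ∑ j, ‖x j‖ ^ 2 := by
  let S : Submodule ℂ H := Submodule.span ℂ (Set.range x)
  have : FiniteDimensional ℂ S := FiniteDimensional.span_of_finite ℂ (Set.finite_range x)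
  let y : Fin n → S := fun j => ⟨x j, Submodule.subset_span ⟨j, rfl⟩⟩
  let b := stdOrthonormalBasis ℂ S
  have hn : ∀ v : S, ‖(v : H)‖ ^ 2 = ∑ k, ‖b.repr v k‖ ^ 2 := fun v => by
    rw [← EuclideanSpace.norm_sq_eq, LinearIsometryEquiv.norm_map]; rfl
  have e1 : ∀ i, ‖∑ j, α i j • x j‖ ^ 2 = ∑ k, ‖∑ j, α i j * b.repr (y j) k‖ ^ 2 := fun i => by
    have h := hn (∑ j, α i j • y j)
    have hy : ((∑ j, α i j • y j : S) : H) = ∑ j, α i j • x j := by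
      rw [Submodule.coe_sum]; rfl
    rw [hy, map_sum] at h
    rw [h]
    refine Finset.sum_congr rfl fun k _ => ?_
    rw [WithLp.ofLp_sum, Finset.sum_apply]
    simp only [map_smul, PiLp.smul_apply, smul_eq_mul]
  have e2 : ∀ j, ‖x j‖ ^ 2 = ∑ k, ‖b.repr (y j) k‖ ^ 2 := fun j => hn (y j)
  simp_rw [e1, e2]
  rw [Finset.sum_comm, Finset.sum_comm (s := (Finset.univ : Finset (Fin n))), Finset.mul_sum]
  exact Finset.sum_le_sum fun k _ => sum_matrix_le α fun j => b.repr (y j) k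

open scoped Matrix.Norms.L2Operator in
noncomputable instance hilbertOSS (H : Type u) [NormedAddCommGroup H] [InnerProductSpace ℂ H] :
    OperatorSequenceSpace H where
  seqNorm n := hilbertSeminorm H n
  eq_zero_of_seqNorm n x h := by
    have h2 := hilbertSeminorm_sq x
    rw [h, zero_pow two_ne_zero, eq_comm, Finset.sum_eq_zero_iff_of_nonneg (by intros; positivity)]
      at h2
    ext i
    simpa using h2 i (Finset.mem_univ i)
  seqNorm_matrix m n α x := by
    rw [hilbertSeminorm_apply, hilbertSeminorm_apply]
    refine Real.sqrt_le_iff.2 ⟨mul_nonneg (norm_nonneg α) (Real.sqrt_nonneg _), ?_⟩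
    rw [mul_pow, Real.sq_sqrt (by positivity)]
    exact sum_matrix_le' α x
  seqNorm_append m n x y := by
    simp only [hilbertSeminorm_sq, Fin.sum_univ_add, Fin.append_left, Fin.append_right, le_refl]

theorem seqNorm_hilbert {H : Type u} [NormedAddCommGroup H] [InnerProductSpace ℂ H] {n : ℕ}
    (x : Fin n → H) :
    OperatorSequenceSpace.seqNorm n x = Real.sqrt (∑ i, ‖x i‖ ^ 2) := rfl

end Hilbert

section Dual

variable (X : Type u) [AddCommGroup X] [Module ℂ X] [OperatorSequenceSpace X]

/-- The sequential dual `X^△ = SB(X, ℂ)`. -/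
def SeqDual : Submodule ℂ (X →ₗ[ℂ] ℂ) where
  carrier := {f | IsSeqBounded f}
  zero_mem' := ⟨0, le_rfl, fun n x => by
    simp only [LinearMap.zero_apply, zero_mul]
    exact (map_zero (OperatorSequenceSpace.seqNorm (E := ℂ) n)).le⟩
  add_mem' := by
    rintro f g ⟨C, hC0, hC⟩ ⟨D, hD0, hD⟩
    refine ⟨C + D, by positivity, fun n x => ?_⟩
    have := map_add_le_add (OperatorSequenceSpace.seqNorm (E := ℂ) n)
      (fun i => f (x i)) (fun i => g (x i))
    rw [add_mul]
    exact this.trans (add_le_add (hC n x) (hD n x))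
  smul_mem' := by
    rintro c f ⟨C, hC0, hC⟩
    refine ⟨‖c‖ * C, by positivity, fun n x => ?_⟩
    have := map_smul_eq_mul (OperatorSequenceSpace.seqNorm (E := ℂ) n) c (fun i => f (x i))
    rw [mul_assoc]
    exact this.le.trans (mul_le_mul_of_nonneg_left (hC n x) (norm_nonneg c))

variable {X}

/-- The operator `X → ℂⁿ = ℓ₂ⁿ` with the coordinates `f 0, …, f (n - 1)`. -/
noncomputable def columnMap {n : ℕ} (f : Fin n → SeqDual X) : X →ₗ[ℂ] EuclideanSpace ℂ (Fin n) where
  toFun x := WithLp.toLp 2 fun i => (f i).1 x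
  map_add' x y := by ext i; simp
  map_smul' c x := by ext i; simp

theorem columnMap_apply {n : ℕ} (f : Fin n → SeqDual X) (x : X) (i : Fin n) :
    columnMap f x i = (f i).1 x := rfl

theorem seqNorm_columnMap_sq {n k : ℕ} (f : Fin n → SeqDual X) (x : Fin k → X) :
    OperatorSequenceSpace.seqNorm k (fun l => columnMap f (x l)) ^ 2
      = ∑ l, ∑ i, ‖(f i).1 (x l)‖ ^ 2 := by
  rw [seqNorm_hilbert, Real.sq_sqrt (by positivity)]
  exact Finset.sum_congr rfl fun l _ => EuclideanSpace.norm_sq_eq _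

theorem columnMap_isSeqBounded {n : ℕ} (f : Fin n → SeqDual X) :
    IsSeqBounded (columnMap f) := by
  choose C hC0 hC using fun i => (f i).2
  refine ⟨Real.sqrt (∑ i, C i ^ 2), Real.sqrt_nonneg _, fun k x => ?_⟩
  have hx : 0 ≤ OperatorSequenceSpace.seqNorm k x := apply_nonneg _ _
  refine le_of_sq_le_sq ?_ (by positivity)
  rw [seqNorm_columnMap_sq, mul_pow, Real.sq_sqrt (by positivity), Finset.sum_comm,
    Finset.sum_mul]
  refine Finset.sum_le_sum fun i _ => ?_
  have := pow_le_pow_left₀ (apply_nonneg _ _) (hC i k x) 2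
  rwa [seqNorm_hilbert, Real.sq_sqrt (by positivity), mul_pow] at this

/-- The norms on `(X^△)ⁿ`, given by the identification of `(X^△)ⁿ` with `SB(X, ℂⁿ)`. -/
noncomputable def dualSeminorm (X : Type u) [AddCommGroup X] [Module ℂ X]
    [OperatorSequenceSpace X] (n : ℕ) : Seminorm ℂ (Fin n → SeqDual X) :=
  Seminorm.ofSMulLE (fun f => sbNorm (columnMap f))
    (le_antisymm (sbNorm_le ⟨le_rfl, fun k x => by
      have : (fun l => columnMap (0 : Fin n → SeqDual X) (x l)) = 0 := by
        ext l i; simp [columnMap_apply]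
      rw [this, map_zero, zero_mul]⟩) (sbNorm_nonneg _))
    (fun f g => sbNorm_le ⟨add_nonneg (sbNorm_nonneg _) (sbNorm_nonneg _), fun k x => by
      have : (fun l => columnMap (f + g) (x l))
          = (fun l => columnMap f (x l)) + fun l => columnMap g (x l) := by
        ext l i; simp [columnMap_apply]
      rw [this, add_mul]
      exact (map_add_le_add _ _ _).trans (add_le_add
        ((sbNorm_mem (columnMap_isSeqBounded f)).2 k x)
        ((sbNorm_mem (columnMap_isSeqBounded g)).2 k x))⟩)
    (fun c f => sbNorm_le ⟨mul_nonneg (norm_nonneg _) (sbNorm_nonneg _), fun k x => by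
      have : (fun l => columnMap (c • f) (x l)) = c • fun l => columnMap f (x l) := by
        ext l i; simp [columnMap_apply]
      rw [this, map_smul_eq_mul, mul_assoc]
      exact mul_le_mul_of_nonneg_left ((sbNorm_mem (columnMap_isSeqBounded f)).2 k x)
        (norm_nonneg _)⟩)

theorem dualSeminorm_apply {n : ℕ} (f : Fin n → SeqDual X) :
    dualSeminorm X n f = sbNorm (columnMap f) := rfl

theorem dualSeminorm_bound {n k : ℕ} (f : Fin n → SeqDual X) (x : Fin k → X) :
    ∑ l, ∑ i, ‖(f i).1 (x l)‖ ^ 2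
      ≤ dualSeminorm X n f ^ 2 * OperatorSequenceSpace.seqNorm k x ^ 2 := by
  rw [← seqNorm_columnMap_sq, ← mul_pow]
  exact pow_le_pow_left₀ (apply_nonneg _ _) ((sbNorm_mem (columnMap_isSeqBounded f)).2 k x) 2

theorem dualSeminorm_le {n : ℕ} (f : Fin n → SeqDual X) {C : ℝ} (hC : 0 ≤ C)
    (h : ∀ (k : ℕ) (x : Fin k → X), ∑ l, ∑ i, ‖(f i).1 (x l)‖ ^ 2
      ≤ C ^ 2 * OperatorSequenceSpace.seqNorm k x ^ 2) : dualSeminorm X n f ≤ C := by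
  refine sbNorm_le ⟨hC, fun k x => ?_⟩
  have hx : 0 ≤ OperatorSequenceSpace.seqNorm k x := apply_nonneg _ _
  refine le_of_sq_le_sq ?_ (by positivity)
  rw [seqNorm_columnMap_sq, mul_pow]
  exact h k x

open scoped Matrix.Norms.L2Operator in
noncomputable instance dualOSS : OperatorSequenceSpace (SeqDual X) where
  seqNorm n := dualSeminorm X n
  eq_zero_of_seqNorm n f h := by
    ext i x
    have := dualSeminorm_bound f (fun _ : Fin 1 => x)
    rw [h] at this
    simp only [Finset.univ_unique, Finset.sum_singleton, ne_eq, OfNat.ofNat_ne_zero,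
      not_false_eq_true, zero_pow, zero_mul] at this
    have h0 := (Finset.sum_eq_zero_iff_of_nonneg (by intros; positivity)).1
      (le_antisymm this (by positivity)) i (Finset.mem_univ i)
    simpa using h0
  seqNorm_matrix m n α f := by
    refine dualSeminorm_le _ (mul_nonneg (norm_nonneg α) (apply_nonneg _ _)) fun k x => ?_
    rw [mul_pow, mul_assoc]
    refine le_trans ?_ (mul_le_mul_of_nonneg_left (dualSeminorm_bound f x) (sq_nonneg _))
    rw [Finset.mul_sum]
    refine Finset.sum_le_sum fun l _ => ?_
    simpa using sum_matrix_le α fun j => (f j).1 (x l)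
  seqNorm_append m n f g := by
    rw [← Real.sq_sqrt (show 0 ≤ dualSeminorm X n f ^ 2 + dualSeminorm X m g ^ 2 by positivity)]
    refine pow_le_pow_left₀ (apply_nonneg _ _) (dualSeminorm_le _ (Real.sqrt_nonneg _) ?_) 2
    intro k x
    rw [Real.sq_sqrt (by positivity), add_mul]
    refine le_trans (le_of_eq ?_) (add_le_add (dualSeminorm_bound f x) (dualSeminorm_bound g x))
    simp only [Fin.sum_univ_add, Fin.append_left, Fin.append_right, Finset.sum_add_distrib]

end Dual

section LInf

variable {ι : Type w} (X : ι → Type u) [∀ i, AddCommGroup (X i)] [∀ i, Module ℂ (X i)]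
  [∀ i, OperatorSequenceSpace (X i)]

open scoped Matrix.Norms.L2Operator in
theorem seqNorm_le_sum {E : Type u} [AddCommGroup E] [Module ℂ E] [OperatorSequenceSpace E]
    {n : ℕ} (x : Fin n → E) :
    OperatorSequenceSpace.seqNorm n x ≤ ∑ k, ‖(Matrix.of fun (i : Fin n) (_ : Fin 1) =>
      if i = k then (1 : ℂ) else 0)‖ * norm1 (x k) := by
  have hx : x = ∑ k, fun i => if i = k then x k else 0 := by
    ext i
    simp [Finset.sum_apply]
  conv_lhs => rw [hx]
  refine (Finset.le_sum_of_subadditive _ (map_zero _).le (map_add_le_add _) _ _).trans (Finset.sum_le_sum fun k _ => ?_)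
  have h := OperatorSequenceSpace.seqNorm_matrix n 1 (Matrix.of fun (i : Fin n) (_ : Fin 1) =>
      if i = k then (1 : ℂ) else 0) (fun _ => x k)
  simpa [norm1] using h

/-- The vector space of families that are bounded in the norms of the underlying spaces. -/
def LInf : Submodule ℂ (∀ i, X i) where
  carrier := {x | ∃ C : ℝ, ∀ i, norm1 (x i) ≤ C}
  zero_mem' := ⟨0, fun i => (map_zero (OperatorSequenceSpace.seqNorm (E := X i) 1)).le⟩
  add_mem' := by
    rintro x y ⟨C, hC⟩ ⟨D, hD⟩
    exact ⟨C + D, fun i => (map_add_le_add (OperatorSequenceSpace.seqNorm (E := X i) 1)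
      (fun _ => x i) (fun _ => y i)).trans (add_le_add (hC i) (hD i))⟩
  smul_mem' := by
    rintro c x ⟨C, hC⟩
    exact ⟨‖c‖ * C, fun i => (map_smul_eq_mul (OperatorSequenceSpace.seqNorm (E := X i) 1) c
      (fun _ => x i)).le.trans (mul_le_mul_of_nonneg_left (hC i) (norm_nonneg c))⟩

variable {X}

open scoped Matrix.Norms.L2Operator in
theorem bddAbove_seqNorm {n : ℕ} (x : Fin n → LInf X) :
    BddAbove (Set.range fun i =>
      OperatorSequenceSpace.seqNorm n (fun k => (x k).1 i)) := by
  choose C hC using fun k => (x k).2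
  refine ⟨∑ k, ‖(Matrix.of fun (i : Fin n) (_ : Fin 1) => if i = k then (1 : ℂ) else 0)‖ * C k, ?_⟩
  rintro _ ⟨i, rfl⟩
  exact (seqNorm_le_sum _).trans (Finset.sum_le_sum fun k _ =>
    mul_le_mul_of_nonneg_left (hC k i) (norm_nonneg _))

theorem seqNorm_coord_le {n : ℕ} (x : Fin n → LInf X) (i : ι) :
    OperatorSequenceSpace.seqNorm n (fun k => (x k).1 i)
      ≤ ⨆ j, OperatorSequenceSpace.seqNorm n (fun k => (x k).1 j) :=
  le_ciSup (bddAbove_seqNorm x) i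

/-- The norms of `(⨁_∞ X i)ⁿ = ⨁_∞ (X i)ⁿ`. -/
noncomputable def lInfSeminorm (X : ι → Type u) [∀ i, AddCommGroup (X i)] [∀ i, Module ℂ (X i)]
    [∀ i, OperatorSequenceSpace (X i)] (n : ℕ) : Seminorm ℂ (Fin n → LInf X) :=
  Seminorm.ofSMulLE
    (fun x => ⨆ i, OperatorSequenceSpace.seqNorm n (fun k => (x k).1 i))
    (by
      have : ∀ i, OperatorSequenceSpace.seqNorm n
          (fun k => ((0 : Fin n → LInf X) k).1 i) = 0 := fun i => map_zero _
      simp only [this, Real.iSup_const_zero])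
    (fun x y => Real.iSup_le
      (fun i => (map_add_le_add (OperatorSequenceSpace.seqNorm (E := X i) n)
        (fun k => (x k).1 i) (fun k => (y k).1 i)).trans
          (add_le_add (seqNorm_coord_le x i) (seqNorm_coord_le y i)))
      (add_nonneg (Real.iSup_nonneg fun _ => apply_nonneg _ _)
        (Real.iSup_nonneg fun _ => apply_nonneg _ _)))
    (fun c x => Real.iSup_le
      (fun i => (map_smul_eq_mul (OperatorSequenceSpace.seqNorm (E := X i) n) c
        (fun k => (x k).1 i)).le.trans
          (mul_le_mul_of_nonneg_left (seqNorm_coord_le x i) (norm_nonneg c)))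
      (mul_nonneg (norm_nonneg c) (Real.iSup_nonneg fun _ => apply_nonneg _ _)))

open scoped Matrix.Norms.L2Operator in
/-- The `⨁_∞`-sum of a family of operator sequence spaces. -/
noncomputable instance lInfOSS : OperatorSequenceSpace (LInf X) where
  seqNorm n := lInfSeminorm X n
  eq_zero_of_seqNorm n x h := by
    have h0 : ∀ i, (fun k => (x k).1 i) = 0 := fun i =>
      OperatorSequenceSpace.eq_zero_of_seqNorm n _
        (le_antisymm ((seqNorm_coord_le x i).trans h.le) (apply_nonneg _ _))
    ext k i
    exact congrFun (h0 i) k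
  seqNorm_matrix m n α x := by
    refine Real.iSup_le (fun i => ?_) (mul_nonneg (norm_nonneg α) (apply_nonneg _ _))
    have h := OperatorSequenceSpace.seqNorm_matrix m n α (fun k => (x k).1 i)
    have e : (fun k => (∑ j, α k j • x j).1 i) = fun k => ∑ j, α k j • (x j).1 i := by
      ext k
      rw [Submodule.coe_sum, Finset.sum_apply]
      rfl
    rw [e]
    exact h.trans (mul_le_mul_of_nonneg_left (seqNorm_coord_le x i) (norm_nonneg α))
  seqNorm_append m n x y := by
    rw [← Real.sq_sqrt (show 0 ≤ lInfSeminorm X n x ^ 2 + lInfSeminorm X m y ^ 2 by positivity)]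
    refine pow_le_pow_left₀ (apply_nonneg _ _) (Real.iSup_le (fun i => ?_) (Real.sqrt_nonneg _)) 2
    refine Real.le_sqrt_of_sq_le ?_
    have e : (fun k => (Fin.append x y k).1 i)
        = Fin.append (fun k => (x k).1 i) (fun k => (y k).1 i) := by
      ext k
      refine Fin.addCases (fun k => ?_) (fun k => ?_) k <;> simp
    rw [e]
    exact (OperatorSequenceSpace.seqNorm_append m n _ _).trans (add_le_add
      (pow_le_pow_left₀ (apply_nonneg _ _) (seqNorm_coord_le x i) 2)
      (pow_le_pow_left₀ (apply_nonneg _ _) (seqNorm_coord_le y i) 2))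

end LInf

section WeakStar

/-- The topology `σ_D(F, E)` on `F` of a pairing `D` of `E` and `F`: `y_ν → y` if and only if
`D x y_ν → D x y` for all `x`. -/
noncomputable abbrev sigmaTopology {E : Type u} {F : Type v} (D : E → F → ℂ) : TopologicalSpace F :=
  TopologicalSpace.induced (fun y x => D x y) Pi.topologicalSpace

/-- The weak* topology of a sequential dual `Z^△`. -/
noncomputable abbrev dualWeakStar (Z : Type u) [AddCommGroup Z] [Module ℂ Z] [OperatorSequenceSpace Z] :
    TopologicalSpace (SeqDual Z) :=
  sigmaTopology fun (z : Z) (f : SeqDual Z) => f.1 z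

/-- `l₂^∞ = ⨁_∞ {l₂ⁿ : n ≥ 1}`; the summand with index `n : ℕ` is the Hilbert space `l₂ⁿ⁺¹`. -/
abbrev L2Inf : Type := LInf fun n : ℕ => EuclideanSpace ℂ (Fin (n + 1))

/-- `⨁_∞ {l₂^∞ : λ ∈ Λ}`. -/
abbrev SumL2Inf (Λ : Type u) : Type u := LInf fun _ : Λ => L2Inf

/-- Families `a` with `a (λ, n) ∈ ℂⁿ⁺¹`, finitely many of them nonzero: the vector space
`⨁_1^0 {t₂^∞ : λ ∈ Λ}`, where `t₂^∞ = ⨁_1^0 {t₂ⁿ : n ≥ 1}`. -/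
def PreSum0 (Λ : Type u) : Set (∀ p : Λ × ℕ, EuclideanSpace ℂ (Fin (p.2 + 1))) :=
  {a | {p | a p ≠ 0}.Finite}

/-- Families `a` with `a (λ, n) ∈ ℂⁿ⁺¹` whose Euclidean norms have a finite sum: the vector space
`⨁_1 {t₂ⁿ : λ ∈ Λ, n ≥ 1}`, the completion of `⨁_1^0 {t₂^∞ : λ ∈ Λ}`. -/
def PreSum1 (Λ : Type u) : Set (∀ p : Λ × ℕ, EuclideanSpace ℂ (Fin (p.2 + 1))) :=
  {a | Summable fun p => ‖a p‖}

/-- The duality `⟨a, y⟩ = ∑_{λ, n} ∑_i a_{λ, n, i} y_{λ, n, i}` between the two preduals above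
and `⨁_∞ {l₂^∞ : λ ∈ Λ}`; the series converges absolutely. -/
noncomputable def sumPairing {Λ : Type u} (a : ∀ p : Λ × ℕ, EuclideanSpace ℂ (Fin (p.2 + 1)))
    (y : SumL2Inf Λ) : ℂ :=
  ∑' p : Λ × ℕ, ∑ i, a p i * (y.1 p.1).1 p.2 i

/-- The weak* topology of `⨁_∞ {l₂^∞ : λ ∈ Λ} = (⨁_1^0 {t₂^∞ : λ ∈ Λ})^△`. -/
noncomputable abbrev sumWeakStar (Λ : Type u) : TopologicalSpace (SumL2Inf Λ) :=
  sigmaTopology fun (a : PreSum0 Λ) (y : SumL2Inf Λ) => sumPairing a.1 y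

/-- The weak* topology of `⨁_∞ {l₂^∞ : λ ∈ Λ}` with respect to the Banach predual `⨁_1`. -/
noncomputable abbrev sumBanachWeakStar (Λ : Type u) : TopologicalSpace (SumL2Inf Λ) :=
  sigmaTopology fun (a : PreSum1 Λ) (y : SumL2Inf Λ) => sumPairing a.1 y

variable (X : Type u) [AddCommGroup X] [Module ℂ X] [OperatorSequenceSpace X]

/-- `X` is a dual operator sequence space: it is sequentially isometrically isomorphic to `Z^△`
for some operator sequence space `Z`, a sequential predual of `X`. -/
def IsDualOSS : Prop :=
  ∃ (Z : Type u) (_ : AddCommGroup Z) (_ : Module ℂ Z) (_ : OperatorSequenceSpace Z)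
    (j : X ≃ₗ[ℂ] SeqDual Z), SeqIsometric (j : X →ₗ[ℂ] SeqDual Z)

/-- `X` is a dual operator sequence space and `τ` is its weak* topology (for some predual). -/
def IsDualOSSWith (τ : TopologicalSpace X) : Prop :=
  ∃ (Z : Type u) (_ : AddCommGroup Z) (_ : Module ℂ Z) (_ : OperatorSequenceSpace Z)
    (j : X ≃ₗ[ℂ] SeqDual Z), SeqIsometric (j : X →ₗ[ℂ] SeqDual Z) ∧
      τ = TopologicalSpace.induced j (dualWeakStar Z)

/-- `X` has a sequential predual that is a Banach operator sequence space. -/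
def IsBanachDualOSS : Prop :=
  ∃ (Z : Type u) (_ : AddCommGroup Z) (_ : Module ℂ Z) (_ : OperatorSequenceSpace Z)
    (j : X ≃ₗ[ℂ] SeqDual Z), IsBanach Z ∧ SeqIsometric (j : X →ₗ[ℂ] SeqDual Z)

/-- `τ` is the weak* topology of `X` for some predual that is a Banach operator sequence space. -/
def IsBanachDualOSSWith (τ : TopologicalSpace X) : Prop :=
  ∃ (Z : Type u) (_ : AddCommGroup Z) (_ : Module ℂ Z) (_ : OperatorSequenceSpace Z)
    (j : X ≃ₗ[ℂ] SeqDual Z), IsBanach Z ∧ SeqIsometric (j : X →ₗ[ℂ] SeqDual Z) ∧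
      τ = TopologicalSpace.induced j (dualWeakStar Z)

end WeakStar

end OpSeq

namespace OpSeq

open OperatorSequenceSpace Filter Topology

/-! ### Level-one norms and the functionals they control -/

section General

variable {E : Type u} [AddCommGroup E] [Module ℂ E] [OperatorSequenceSpace E]

/-! Write `L_Λ` for the sum of copies of `l₂^∞`. It is the dual of every space `P` of families
between the finitely supported and the absolutely summable ones. Proving everything for such a `P`
treats the two weak* topologies together.

From a predual to an embedding: the norms of `Z^△` are suprema of `(∑ |f_l (z_i)|²)^{1/2}` over
tuples `z` in the unit balls of the `Zⁿ`. Evaluation at all these tuples is therefore sequentially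
isometric into `L_Λ` (`ballEmbedding_seqIsometric`). Its range is cut out by pointwise conditions,
namely linearity and consistency of the coordinates, so it is closed. The topologies agree when
pairing with `P` yields only points of `Z`: finite combinations always, absolutely convergent series
when `Z` is Banach.

From an embedding `φ` to a predual: take the functionals `x ↦ ⟨a, φ x⟩`, `a ∈ P`, with the norms of
`X^△`. Evaluation of `X` on them is sequentially isometric because the coordinate tuples of `φ` have
norm at most one. It is onto: a bounded functional pulls back to `P`, is represented by some `y ∈
L_Λ`, and kills every `a` that annihilates `range φ`; since the range is closed, `y` lies in it
(`exists_eq_restrictedPairing`). For summable families, Hahn–Banach identifies this predual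
isometrically with a quotient of an `ℓ¹`-sum, so it is complete (`isBanach_predual`). -/

theorem norm_sum_mul_le {n : ℕ} (c d : EuclideanSpace ℂ (Fin n)) :
    ‖∑ i, c i * d i‖ ≤ ‖c‖ * ‖d‖ := by
  rw [EuclideanSpace.norm_eq, EuclideanSpace.norm_eq]
  refine (norm_sum_le _ _).trans ?_
  simp only [norm_mul]
  exact Real.sum_mul_le_sqrt_mul_sqrt _ _ _

/-- A bound for bilinear pairings with `ℂⁿ` bounds the Euclidean norm. -/
theorem norm_le_of_forall_sum_mul_le {n : ℕ} {d : EuclideanSpace ℂ (Fin n)} {C : ℝ} (hC : 0 ≤ C)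
    (h : ∀ c : EuclideanSpace ℂ (Fin n), ‖∑ i, c i * d i‖ ≤ C * ‖c‖) : ‖d‖ ≤ C := by
  -- The pairing is bilinear, so the test vector is the conjugate of `d`; this gives `‖d‖² ≤ C ‖d‖`.
  have h1 := h (WithLp.toLp 2 fun i => star (d i))
  have h2 : ‖(WithLp.toLp 2 fun i => star (d i) : EuclideanSpace ℂ (Fin n))‖ = ‖d‖ := by
    simp [EuclideanSpace.norm_eq]
  have h3 : ∑ i, star (d i) * d i = ((‖d‖ ^ 2 : ℝ) : ℂ) := by
    rw [EuclideanSpace.norm_sq_eq]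
    push_cast
    exact Finset.sum_congr rfl fun i _ => by
      rw [← Complex.conj_mul']; rfl
  rw [h2] at h1
  change ‖∑ i, star (d i) * d i‖ ≤ _ at h1
  rw [h3, Complex.norm_real, Real.norm_of_nonneg (by positivity), pow_two] at h1
  rcases (norm_nonneg d).eq_or_lt with h0 | h0
  · rw [← h0]; exact hC
  · exact le_of_mul_le_mul_right h1 h0

open scoped Matrix.Norms.L2Operator in
theorem norm_row_le {n : ℕ} (c : EuclideanSpace ℂ (Fin n)) :
    ‖(Matrix.of fun (_ : Fin 1) (j : Fin n) => c j)‖ ≤ ‖c‖ := by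
  rw [Matrix.l2_opNorm_def]
  refine ContinuousLinearMap.opNorm_le_bound _ (norm_nonneg _) fun d => ?_
  refine le_trans (le_of_eq ?_) (norm_sum_mul_le c d)
  rw [EuclideanSpace.norm_eq]
  simp [Matrix.mulVec, dotProduct]

/-- The matrix axiom for a single row, whose operator norm is at most its Euclidean norm. It lets
level-one estimates control all levels. -/
theorem norm1_sum_smul_le {n : ℕ} (c : EuclideanSpace ℂ (Fin n)) (x : Fin n → E) :
    norm1 (∑ i, c i • x i) ≤ ‖c‖ * seqNorm n x :=
  (seqNorm_matrix 1 n (Matrix.of fun _ j => c j) x).trans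
    (mul_le_mul_of_nonneg_right (norm_row_le c) (apply_nonneg _ _))

theorem norm1_nonneg (x : E) : 0 ≤ norm1 x := apply_nonneg _ _

theorem norm1_add_le (x y : E) : norm1 (x + y) ≤ norm1 x + norm1 y :=
  map_add_le_add (seqNorm 1) (fun _ => x) (fun _ => y)

theorem norm1_smul (c : ℂ) (x : E) : norm1 (c • x) = ‖c‖ * norm1 x :=
  map_smul_eq_mul (seqNorm 1) c (fun _ => x)

theorem norm1_eq_zero {x : E} (h : norm1 x = 0) : x = 0 :=
  congrFun (eq_zero_of_seqNorm 1 _ h) 0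

theorem norm1_normedSpaceCore (E : Type u) [AddCommGroup E] [Module ℂ E]
    [OperatorSequenceSpace E] :
    letI : Norm E := ⟨norm1⟩
    NormedSpace.Core ℂ E :=
  letI : Norm E := ⟨norm1⟩
  { norm_nonneg := norm1_nonneg
    norm_smul := norm1_smul
    norm_triangle := norm1_add_le
    norm_eq_zero_iff := fun x => ⟨norm1_eq_zero, fun h => by
      rw [h]; exact map_zero (seqNorm (E := E) 1)⟩ }

/-- The underlying normed space of an operator sequence space. -/
noncomputable abbrev norm1Group (E : Type u) [AddCommGroup E] [Module ℂ E] [OperatorSequenceSpace E] :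
    NormedAddCommGroup E :=
  letI : Norm E := ⟨norm1⟩
  NormedAddCommGroup.ofCore (norm1_normedSpaceCore E)

/-- The underlying normed space of an operator sequence space. -/
noncomputable abbrev norm1Space (E : Type u) [AddCommGroup E] [Module ℂ E] [OperatorSequenceSpace E] :
    letI := norm1Group E
    NormedSpace ℂ E :=
  letI : Norm E := ⟨norm1⟩
  letI := norm1Group E
  NormedSpace.ofCore (norm1_normedSpaceCore E)

theorem isBanach_iff_completeSpace (E : Type u) [AddCommGroup E] [Module ℂ E]
    [OperatorSequenceSpace E] :
    letI := norm1Group E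
    IsBanach E ↔ CompleteSpace E := by
  let := norm1Group E
  have hd : ∀ x y : E, dist x y = norm1 (x - y) := fun x y => dist_eq_norm x y
  constructor
  · intro h
    refine Metric.complete_of_cauchySeq_tendsto fun s hs => ?_
    obtain ⟨x, hx⟩ := h s fun ε hε => by
      obtain ⟨N, hN⟩ := Metric.cauchySeq_iff.1 hs ε hε
      exact ⟨N, fun m hm n hn => by rw [← hd]; exact hN m hm n hn⟩
    refine ⟨x, Metric.tendsto_atTop.2 fun ε hε => ?_⟩
    simpa only [hd] using hx ε hε
  · intro h s hs
    obtain ⟨x, hx⟩ := cauchySeq_tendsto_of_complete (u := s) (Metric.cauchySeq_iff.2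
      fun ε hε => by simpa only [hd] using hs ε hε)
    refine ⟨x, fun ε hε => ?_⟩
    simpa only [hd] using Metric.tendsto_atTop.1 hx ε hε

/-- A functional is sequentially bounded by every bound of its first amplification. -/
theorem mem_seqBounds_of_norm_le {f : E →ₗ[ℂ] ℂ} {C : ℝ} (hC : 0 ≤ C)
    (h : ∀ x, ‖f x‖ ≤ C * norm1 x) : C ∈ seqBounds f := by
  refine ⟨hC, fun n x => ?_⟩
  -- Pairing `(f (x i))ᵢ` with `c` gives `f (∑ c i • x i)`, where the level-one bound applies.
  have := norm_le_of_forall_sum_mul_le (d := WithLp.toLp 2 fun i => f (x i))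
    (C := C * seqNorm n x) (mul_nonneg hC (apply_nonneg _ _)) fun c => by
      have h1 := (h (∑ i, c i • x i)).trans
        (mul_le_mul_of_nonneg_left (norm1_sum_smul_le c x) hC)
      simp only [map_sum, map_smul, smul_eq_mul] at h1
      exact h1.trans (le_of_eq (by ring))
  rwa [EuclideanSpace.norm_eq] at this

theorem norm1_seqDual_le {f : SeqDual E} {C : ℝ} (hC : 0 ≤ C)
    (h : ∀ x, ‖f.1 x‖ ≤ C * norm1 x) : norm1 f ≤ C := by
  refine dualSeminorm_le _ hC fun k x => ?_
  have h1 := pow_le_pow_left₀ (apply_nonneg _ _) ((mem_seqBounds_of_norm_le hC h).2 k x) 2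
  rw [seqNorm_hilbert, Real.sq_sqrt (by positivity), mul_pow] at h1
  simpa using h1

theorem norm_apply_le (f : SeqDual E) (x : E) : ‖f.1 x‖ ≤ norm1 f * norm1 x := by
  have := dualSeminorm_bound (fun _ : Fin 1 => f) (fun _ : Fin 1 => x)
  rw [← mul_pow] at this
  simp only [Finset.univ_unique, Finset.sum_singleton] at this
  exact le_of_sq_le_sq this (mul_nonneg (norm1_nonneg _) (norm1_nonneg _))

open scoped Matrix.Norms.L2Operator in
/-- A subspace of an operator sequence space with the inherited norms. -/
noncomputable instance submoduleOSS (S : Submodule ℂ E) : OperatorSequenceSpace S where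
  seqNorm n := (seqNorm (E := E) n).comp (LinearMap.compLeft S.subtype (Fin n))
  eq_zero_of_seqNorm n x h := by
    have := eq_zero_of_seqNorm (E := E) n (fun i => (x i : E)) h
    ext i
    exact congrFun this i
  seqNorm_matrix m n α x := by
    have := seqNorm_matrix (E := E) m n α fun i => (x i : E)
    have e : (fun i => ((∑ j, α i j • x j : S) : E)) = fun i => ∑ j, α i j • (x j : E) := by
      ext i
      simp
    rw [← e] at this
    exact this
  seqNorm_append m n x y := by
    have := seqNorm_append (E := E) m n (fun i => (x i : E)) (fun i => (y i : E))
    have e : (fun i => ((Fin.append x y i : S) : E))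
        = Fin.append (fun i => (x i : E)) (fun i => (y i : E)) := by
      ext k
      refine Fin.addCases (fun k => ?_) (fun k => ?_) k <;> simp
    rw [← e] at this
    exact this

theorem SeqIsometric.norm1_eq {F : Type v} [AddCommGroup F] [Module ℂ F]
    [OperatorSequenceSpace F] {φ : E →ₗ[ℂ] F} (h : SeqIsometric φ) (x : E) :
    norm1 (φ x) = norm1 x := h 1 fun _ => x

theorem SeqIsometric.injective {F : Type v} [AddCommGroup F] [Module ℂ F]
    [OperatorSequenceSpace F] {φ : E →ₗ[ℂ] F} (h : SeqIsometric φ) : Function.Injective φ := by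
  refine (injective_iff_map_eq_zero φ).2 fun x hx => norm1_eq_zero ?_
  rw [← h.norm1_eq, hx]
  exact map_zero (seqNorm (E := F) 1)

end General

/-- A subspace that is closed in the topology of a pairing is separated from the points outside
by the pairing. -/
theorem exists_pairing_ne_zero {A : Type u} {F : Type v} [AddCommGroup A] [Module ℂ A]
    [AddCommGroup F] [Module ℂ F] (D : A →ₗ[ℂ] F →ₗ[ℂ] ℂ) (S : Submodule ℂ F)
    (hS : @IsClosed F (sigmaTopology fun a y => D a y) (S : Set F)) {y : F} (hy : y ∉ S) :
    ∃ a, (∀ s ∈ S, D a s = 0) ∧ D a y ≠ 0 := by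
  classical
  obtain ⟨U, hU, hUS⟩ := isOpen_induced_iff.1 hS.1
  have hyU : (fun a => D a y) ∈ U := by
    have : y ∈ (fun (y : F) (a : A) => D a y) ⁻¹' U := by rw [hUS]; exact hy
    exact this
  obtain ⟨I, u, hu, hIU⟩ := isOpen_pi_iff.1 hU _ hyU
  -- A basic neighbourhood of `y` missing `S` restricts only the finitely many coordinates in `I`,
  -- so `y` is already separated from `S` in the finite-dimensional space `I → ℂ`.
  let T : F →ₗ[ℂ] (I → ℂ) := LinearMap.pi fun a => D a
  have hT : T y ∉ S.map T := by
    rintro ⟨s, hs, hsy⟩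
    have : s ∈ (fun (y : F) (a : A) => D a y) ⁻¹' U := hIU fun a ha => by
      have h1 : D a s = D a y := congrFun hsy ⟨a, ha⟩
      change D a s ∈ u a
      rw [h1]
      exact (hu a ha).2
    rw [hUS] at this
    exact this hs
  obtain ⟨g, hg, hgS⟩ := Submodule.exists_le_ker_of_notMem hT
  -- A functional on `I → ℂ` is a combination of coordinates, so `g ∘ T` is the pairing with one
  -- element of `A`.
  have hga : ∀ v : F, D (∑ a : I, g (Pi.single a 1) • (a : A)) v = g (T v) := fun v => by
    conv_rhs => rw [LinearMap.pi_apply_eq_sum_univ g (T v)]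
    simp only [map_sum, map_smul, LinearMap.sum_apply, LinearMap.smul_apply, smul_eq_mul]
    refine Finset.sum_congr rfl fun a _ => ?_
    rw [mul_comm]
    congr 2
    ext b; simp [Pi.single_apply, eq_comm]
  exact ⟨∑ a : I, g (Pi.single a 1) • (a : A),
    fun s hs => by rw [hga]; exact hgS (Submodule.mem_map_of_mem hs), by rwa [hga]⟩

/-! ### Coordinates of `L_Λ` and its duality with summable families -/

section Coordinates

variable {Λ : Type u}

/-- The families with members in `ℂⁿ⁺¹`, for `(λ, n) ∈ Λ × ℕ`. -/
abbrev Family (Λ : Type u) : Type u := ∀ p : Λ × ℕ, EuclideanSpace ℂ (Fin (p.2 + 1))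

/-- The member of `y` with index `(λ, n)`. -/
def coord (y : SumL2Inf Λ) (p : Λ × ℕ) : EuclideanSpace ℂ (Fin (p.2 + 1)) := (y.1 p.1).1 p.2

theorem coord_add (y z : SumL2Inf Λ) (p : Λ × ℕ) : coord (y + z) p = coord y p + coord z p := rfl

theorem coord_ext {y z : SumL2Inf Λ} (h : ∀ p, coord y p = coord z p) : y = z :=
  Subtype.ext <| funext fun l => Subtype.ext <| funext fun m => h (l, m)

theorem norm1_hilbert {H : Type u} [NormedAddCommGroup H] [InnerProductSpace ℂ H] (x : H) :
    norm1 x = ‖x‖ := by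
  change √(∑ _ : Fin 1, ‖x‖ ^ 2) = _
  simp

theorem seqNorm_coord_le_seqNorm {n : ℕ} (y : Fin n → SumL2Inf Λ) (p : Λ × ℕ) :
    seqNorm n (fun k => coord (y k) p) ≤ (lInfOSS (X := fun _ : Λ => L2Inf)).seqNorm n y :=
  (seqNorm_coord_le (X := fun m : ℕ => EuclideanSpace ℂ (Fin (m + 1)))
    (fun k => (y k).1 p.1) p.2).trans (seqNorm_coord_le (X := fun _ : Λ => L2Inf) y p.1)

theorem seqNorm_le_of_coord {n : ℕ} {y : Fin n → SumL2Inf Λ} {C : ℝ} (hC : 0 ≤ C)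
    (h : ∀ p, seqNorm n (fun k => coord (y k) p) ≤ C) : (lInfOSS (X := fun _ : Λ => L2Inf)).seqNorm n y ≤ C :=
  Real.iSup_le (fun l => Real.iSup_le (fun m => h (l, m)) hC) hC

theorem norm_coord_le (y : SumL2Inf Λ) (p : Λ × ℕ) : ‖coord y p‖ ≤ norm1 (E := SumL2Inf Λ) y := by
  rw [← norm1_hilbert]
  exact seqNorm_coord_le_seqNorm (fun _ : Fin 1 => y) p

theorem norm1_le_of_coord {y : SumL2Inf Λ} {C : ℝ} (hC : 0 ≤ C) (h : ∀ p, ‖coord y p‖ ≤ C) :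
    norm1 (E := SumL2Inf Λ) y ≤ C :=
  seqNorm_le_of_coord hC fun p => (norm1_hilbert (coord y p)).le.trans (h p)

/-- A bounded family, as an element of `⨁_∞ {l₂^∞ : λ ∈ Λ}`. -/
def ofFamily (y : Family Λ) (C : ℝ) (h : ∀ p, ‖y p‖ ≤ C) : SumL2Inf Λ :=
  ⟨fun l => ⟨fun m => y (l, m), C, fun m => (norm1_hilbert _).le.trans (h (l, m))⟩,
    max C 0, fun l => Real.iSup_le (fun m =>
      (norm1_hilbert (y (l, m))).le.trans ((h (l, m)).trans (le_max_left _ _))) (le_max_right _ _)⟩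

theorem coord_ofFamily (y : Family Λ) (C : ℝ) (h : ∀ p, ‖y p‖ ≤ C) (p : Λ × ℕ) :
    coord (ofFamily y C h) p = y p := rfl

/-- The finitely supported families. -/
def finFamilies (Λ : Type u) : Submodule ℂ (Family Λ) where
  carrier := PreSum0 Λ
  zero_mem' := by simp [PreSum0]
  add_mem' := fun {a b} ha hb => (Set.Finite.union ha hb).subset fun p hp => by
    by_contra h
    simp only [Set.mem_union, Set.mem_ofPred_eq, not_or, not_not] at h
    exact hp (by rw [Pi.add_apply, h.1, h.2, add_zero])
  smul_mem' := fun c a ha => Set.Finite.subset ha fun p hp h => hp (by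
    rw [Pi.smul_apply, h, smul_zero])

/-- The absolutely summable families. -/
def sumFamilies (Λ : Type u) : Submodule ℂ (Family Λ) where
  carrier := PreSum1 Λ
  zero_mem' := by simp only [PreSum1, Set.mem_ofPred_eq, Pi.zero_apply, norm_zero]; exact summable_zero
  add_mem' := fun {a b} ha hb => Summable.of_nonneg_of_le (fun p => norm_nonneg _)
    (fun p => norm_add_le (a p) (b p)) (Summable.add ha hb)
  smul_mem' := fun c a ha => by
    have : Summable fun p => ‖c‖ * ‖a p‖ := Summable.mul_left _ ha
    simpa only [PreSum1, Set.mem_ofPred_eq, Pi.smul_apply, norm_smul] using this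

theorem finFamilies_le : finFamilies Λ ≤ sumFamilies Λ := fun a ha =>
  summable_of_hasFiniteSupport (Set.Finite.subset ha fun p hp h => hp (by
    change ‖a p‖ = 0
    rw [h, norm_zero]))

theorem norm_pairing_term_le (a : Family Λ) (y : SumL2Inf Λ) (p : Λ × ℕ) :
    ‖∑ i, a p i * coord y p i‖ ≤ ‖a p‖ * norm1 (E := SumL2Inf Λ) y :=
  (norm_sum_mul_le _ _).trans (mul_le_mul_of_nonneg_left (norm_coord_le y p) (norm_nonneg _))

theorem summable_pairing {a : Family Λ} (ha : a ∈ sumFamilies Λ) (y : SumL2Inf Λ) :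
    Summable fun p => ∑ i, a p i * coord y p i :=
  Summable.of_norm_bounded (g := fun p => ‖a p‖ * norm1 (E := SumL2Inf Λ) y) (Summable.mul_right _ ha) (norm_pairing_term_le a y)

theorem hasSum_sumPairing {a : Family Λ} (ha : a ∈ sumFamilies Λ) (y : SumL2Inf Λ) :
    HasSum (fun p => ∑ i, a p i * coord y p i) (sumPairing a y) :=
  (summable_pairing ha y).hasSum

theorem norm_sumPairing_le {a : Family Λ} (ha : a ∈ sumFamilies Λ) (y : SumL2Inf Λ) :
    ‖sumPairing a y‖ ≤ (∑' p, ‖a p‖) * norm1 (E := SumL2Inf Λ) y := by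
  rw [← tsum_mul_right]
  exact tsum_of_norm_bounded (Summable.mul_right _ ha).hasSum (norm_pairing_term_le a y)

/-- The duality of a space of summable families with `⨁_∞ {l₂^∞ : λ ∈ Λ}`. -/
noncomputable def pairing {P : Submodule ℂ (Family Λ)} (hP : P ≤ sumFamilies Λ) :
    P →ₗ[ℂ] SumL2Inf Λ →ₗ[ℂ] ℂ :=
  LinearMap.mk₂ ℂ (fun a y => sumPairing a.1 y)
    (fun a b y => ((hasSum_sumPairing (hP (a + b).2) y).unique (by
      convert (hasSum_sumPairing (hP a.2) y).add (hasSum_sumPairing (hP b.2) y) using 2 with p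
      simp [add_mul, Finset.sum_add_distrib])))
    (fun c a y => ((hasSum_sumPairing (hP (c • a).2) y).unique (by
      refine ((hasSum_sumPairing (hP a.2) y).mul_left c).congr_fun fun p => ?_
      rw [Finset.mul_sum]
      exact Finset.sum_congr rfl fun i _ => mul_assoc _ _ _)))
    (fun a y z => ((hasSum_sumPairing (hP a.2) (y + z)).unique (by
      convert (hasSum_sumPairing (hP a.2) y).add (hasSum_sumPairing (hP a.2) z) using 2 with p
      simp [coord_add, mul_add, Finset.sum_add_distrib])))
    (fun c a y => ((hasSum_sumPairing (hP a.2) (c • y)).unique (by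
      refine ((hasSum_sumPairing (hP a.2) y).mul_left c).congr_fun fun p => ?_
      rw [Finset.mul_sum]
      exact Finset.sum_congr rfl fun i _ => mul_left_comm _ _ _)))

theorem pairing_apply {P : Submodule ℂ (Family Λ)} (hP : P ≤ sumFamilies Λ) (a : P)
    (y : SumL2Inf Λ) : pairing hP a y = sumPairing a.1 y := rfl

open scoped Classical in
/-- The family whose only nonzero member is `c`, at the index `p`. -/
noncomputable def single (p : Λ × ℕ) : EuclideanSpace ℂ (Fin (p.2 + 1)) →ₗ[ℂ] Family Λ :=
  LinearMap.single ℂ (fun p : Λ × ℕ => EuclideanSpace ℂ (Fin (p.2 + 1))) p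

theorem single_same (p : Λ × ℕ) (c : EuclideanSpace ℂ (Fin (p.2 + 1))) : single p c p = c := by
  classical
  simp [single]

theorem single_of_ne {p q : Λ × ℕ} (h : q ≠ p) (c : EuclideanSpace ℂ (Fin (p.2 + 1))) :
    single p c q = 0 := by
  classical
  simp [single, h]

theorem sum_single (s : Finset (Λ × ℕ)) [DecidableEq (Λ × ℕ)] (a : Family Λ) (q : Λ × ℕ) :
    ∑ p ∈ s, single p (a p) q = if q ∈ s then a q else 0 := by
  split_ifs with h
  · rw [Finset.sum_eq_single_of_mem q h fun p _ hp => single_of_ne hp.symm _, single_same]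
  · exact Finset.sum_eq_zero fun p hp => single_of_ne (fun e : q = p => h (e.symm ▸ hp)) _

theorem single_mem (p : Λ × ℕ) (c : EuclideanSpace ℂ (Fin (p.2 + 1))) :
    single p c ∈ finFamilies Λ :=
  (Set.finite_singleton p).subset fun q hq => by
    by_contra h
    exact hq (single_of_ne h c)

theorem sumPairing_single (p : Λ × ℕ) (c : EuclideanSpace ℂ (Fin (p.2 + 1))) (y : SumL2Inf Λ) :
    sumPairing (single p c) y = ∑ i, c i * coord y p i := by
  unfold sumPairing
  rw [tsum_eq_single p fun q hq => by simp [single_of_ne hq], single_same]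
  rfl

theorem sumPairing_single_basis (p : Λ × ℕ) (i : Fin (p.2 + 1)) (y : SumL2Inf Λ) :
    sumPairing (single p (EuclideanSpace.single i 1)) y = coord y p i := by
  rw [sumPairing_single]
  simp

theorem tsum_norm_single (p : Λ × ℕ) (c : EuclideanSpace ℂ (Fin (p.2 + 1))) :
    ∑' q, ‖single p c q‖ = ‖c‖ := by
  rw [tsum_eq_single p fun q hq => by rw [single_of_ne hq, norm_zero], single_same]

/-- A bounded functional on a space of summable families is represented by a bounded family. -/
theorem exists_eq_sumPairing {P : Submodule ℂ (Family Λ)} (h0 : finFamilies Λ ≤ P)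
    (h1 : P ≤ sumFamilies Λ) (G : P →ₗ[ℂ] ℂ) {C : ℝ} (hC : 0 ≤ C)
    (hG : ∀ a, ‖G a‖ ≤ C * ∑' p, ‖a.1 p‖) :
    ∃ y : SumL2Inf Λ, norm1 (E := SumL2Inf Λ) y ≤ C ∧ ∀ a, G a = sumPairing a.1 y := by
  classical
  let e : ∀ p : Λ × ℕ, EuclideanSpace ℂ (Fin (p.2 + 1)) →ₗ[ℂ] P := fun p =>
    (single p).codRestrict P fun c => h0 (single_mem p c)
  let y : Family Λ := fun p => WithLp.toLp 2 fun i => G (e p (EuclideanSpace.single i 1))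
  have hy : ∀ p (c : EuclideanSpace ℂ (Fin (p.2 + 1))), ∑ i, c i * y p i = G (e p c) := by
    intro p c
    have hc : c = ∑ i, c i • EuclideanSpace.single i (1 : ℂ) := by
      ext k
      simp [Finset.sum_apply, Pi.single_apply]
    conv_rhs => rw [hc]
    simp [y]
  have hyC : ∀ p, ‖y p‖ ≤ C := fun p => norm_le_of_forall_sum_mul_le hC fun c => by
    rw [hy]
    refine (hG _).trans (le_of_eq ?_)
    rw [← tsum_norm_single p c]
    rfl
  refine ⟨ofFamily y C hyC, norm1_le_of_coord hC hyC, fun a => ?_⟩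
  refine HasSum.unique ?_ (hasSum_sumPairing (h1 a.2) _)
  simp only [coord_ofFamily, hy]
  -- Over a finite set `s`, the partial sum is `G` of the truncation of `a` to `s`. The error is at
  -- most `C` times the `ℓ¹`-tail of `a` outside `s`, which tends to zero.
  have hs : Summable fun p => ‖a.1 p‖ := h1 a.2
  have ht := (tendsto_tsum_compl_atTop_zero fun p => ‖a.1 p‖).const_mul C
  rw [mul_zero] at ht
  refine tendsto_iff_norm_sub_tendsto_zero.2 (squeeze_zero (fun _ => norm_nonneg _) (fun s => ?_) ht)
  rw [norm_sub_rev, ← map_sum, ← map_sub]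
  refine (hG _).trans (le_of_eq ?_)
  congr 1
  refine Eq.trans ?_ (tsum_subtype {x | x ∉ s} fun p => ‖a.1 p‖).symm
  refine tsum_congr fun q => ?_
  have hq : (a - ∑ p ∈ s, e p (a.1 p)).1 q = a.1 q - if q ∈ s then a.1 q else 0 := by
    simp only [Submodule.coe_sub, Submodule.coe_sum, Pi.sub_apply, Finset.sum_apply]
    congr 1
    exact sum_single s a.1 q
  rw [hq]
  by_cases h : q ∈ s <;> simp [h]

end Coordinates

/-! ### Topologies of pairings -/

theorem sigmaTopology_eq_iInf {A : Type u} {F : Type v} (D : A → F → ℂ) :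
    sigmaTopology D = ⨅ a, TopologicalSpace.induced (D a) inferInstance := by
  simp only [sigmaTopology, Pi.topologicalSpace, induced_iInf, induced_compose]
  rfl

theorem continuous_sigmaTopology {A : Type u} {F : Type v} (D : A → F → ℂ) (a : A) :
    Continuous[sigmaTopology D, inferInstance] (D a) := by
  rw [continuous_iff_le_induced, sigmaTopology_eq_iInf]
  exact iInf_le _ a

/-- The topology of a pairing depends only on the set of functionals, and the hypotheses say that
these sets coincide on `F`. -/
theorem sigmaTopology_eq_induced {A B F G : Type*} (D : A → F → ℂ) (D' : B → G → ℂ) (φ : F → G)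
    (h1 : ∀ a, ∃ b, ∀ f, D a f = D' b (φ f)) (h2 : ∀ b, ∃ a, ∀ f, D' b (φ f) = D a f) :
    sigmaTopology D = TopologicalSpace.induced φ (sigmaTopology D') := by
  simp only [sigmaTopology_eq_iInf, induced_iInf, induced_compose]
  refine le_antisymm (le_iInf fun b => ?_) (le_iInf fun a => ?_)
  · obtain ⟨a, ha⟩ := h2 b
    rw [show D' b ∘ φ = D a from funext ha]
    exact iInf_le _ a
  · obtain ⟨b, hb⟩ := h1 a
    rw [show D a = D' b ∘ φ from funext hb]
    exact iInf_le _ b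

/-! ### Embedding a sequential dual by evaluation on unit balls -/

section Embedding

variable (Z : Type u) [AddCommGroup Z] [Module ℂ Z] [OperatorSequenceSpace Z]

/-- The choices of an element in the unit ball of `Zⁿ⁺¹` for each `n`. -/
abbrev BallChoice : Type u := ∀ n : ℕ, {z : Fin (n + 1) → Z // seqNorm (n + 1) z ≤ 1}

variable {Z}

/-- An index `λ` carries a coordinate for every size at once, so it has to choose a tuple of every
size; zero tuples fill the irrelevant ones. Every unit-ball tuple therefore occurs as a coordinate.
-/
theorem exists_ballChoice {n : ℕ} {z : Fin (n + 1) → Z} (hz : seqNorm (n + 1) z ≤ 1) :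
    ∃ l : BallChoice Z, (l n).1 = z := by
  classical
  refine ⟨Function.update (fun m => ⟨0, by rw [map_zero]; exact zero_le_one⟩) n ⟨z, hz⟩, ?_⟩
  rw [Function.update_self]

theorem sum_ballChoice_le {n : ℕ} (f : Fin n → SeqDual Z) (p : BallChoice Z × ℕ) :
    ∑ l, ∑ i, ‖(f l).1 ((p.1 p.2).1 i)‖ ^ 2 ≤ dualSeminorm Z n f ^ 2 := by
  rw [Finset.sum_comm]
  refine (dualSeminorm_bound f _).trans (mul_le_of_le_one_right (sq_nonneg _) ?_)
  exact pow_le_one₀ (apply_nonneg _ _) (p.1 p.2).2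

theorem norm_ballChoice_le (f : SeqDual Z) (p : BallChoice Z × ℕ) :
    ‖(WithLp.toLp 2 fun i => f.1 ((p.1 p.2).1 i) : EuclideanSpace ℂ (Fin (p.2 + 1)))‖
      ≤ norm1 f := by
  refine le_of_sq_le_sq ?_ (norm1_nonneg f)
  have h := sum_ballChoice_le (fun _ : Fin 1 => f) p
  rw [Finset.univ_unique, Finset.sum_singleton] at h
  rw [EuclideanSpace.norm_sq_eq]
  exact h

variable (Z) in
/-- The embedding of `Z^△` given by evaluation in the unit balls of the spaces `Zⁿ`. -/
noncomputable def ballEmbedding : SeqDual Z →ₗ[ℂ] SumL2Inf (BallChoice Z) where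
  toFun f := ofFamily (fun p => WithLp.toLp 2 fun i => f.1 ((p.1 p.2).1 i)) (norm1 f)
    (norm_ballChoice_le f)
  map_add' _ _ := coord_ext fun _ => rfl
  map_smul' _ _ := coord_ext fun _ => rfl

theorem coord_ballEmbedding (f : SeqDual Z) (p : BallChoice Z × ℕ) (i : Fin (p.2 + 1)) :
    coord (ballEmbedding Z f) p i = f.1 ((p.1 p.2).1 i) := rfl

theorem exists_unit_smul {n : ℕ} (z : Fin (n + 1) → Z) :
    ∃ w : Fin (n + 1) → Z, seqNorm (n + 1) w ≤ 1 ∧ z = ((seqNorm (n + 1) z : ℝ) : ℂ) • w := by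
  have h0 : 0 ≤ seqNorm (n + 1) z := apply_nonneg _ _
  rcases h0.eq_or_lt with h | h
  · refine ⟨0, by rw [map_zero]; exact zero_le_one, ?_⟩
    rw [smul_zero]
    exact eq_zero_of_seqNorm _ _ h.symm
  · have hc : ((seqNorm (n + 1) z : ℝ) : ℂ) ≠ 0 := Complex.ofReal_ne_zero.2 h.ne'
    refine ⟨((seqNorm (n + 1) z : ℝ) : ℂ)⁻¹ • z, ?_, ?_⟩
    · rw [map_smul_eq_mul, norm_inv, Complex.norm_real, Real.norm_of_nonneg h0,
        inv_mul_cancel₀ h.ne']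
    · rw [smul_smul, mul_inv_cancel₀ hc, one_smul]

/-- Each element of `Z` acts on `Z^△` as a multiple of a coordinate of the embedding. -/
theorem exists_ball_coordinate (z : Z) :
    ∃ l : BallChoice Z, z = (norm1 z : ℂ) • (l 0).1 0 := by
  obtain ⟨w, hw, hz⟩ := exists_unit_smul fun _ : Fin 1 => z
  obtain ⟨l, hl⟩ := exists_ballChoice hw
  exact ⟨l, by rw [hl]; exact congrFun hz 0⟩

/-- By homogeneity the least constant in the dual norm is tested on unit balls, and each such test
is one coordinate: both are the double sum of `|f_l (z_i)|²`, summed in either order. -/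
theorem ballEmbedding_seqIsometric : SeqIsometric (Y := SumL2Inf (BallChoice Z)) (ballEmbedding Z) := by
  intro n f
  refine le_antisymm (seqNorm_le_of_coord (apply_nonneg _ _) fun p => ?_)
    (dualSeminorm_le f (apply_nonneg _ _) fun k x => ?_)
  · rw [seqNorm_hilbert]
    refine Real.sqrt_le_iff.2 ⟨apply_nonneg _ _, ?_⟩
    simp only [EuclideanSpace.norm_sq_eq]
    exact sum_ballChoice_le f p
  -- The coordinate with index `k` belongs to tuples of length `k + 1`; the empty tuple has none,
  -- but its bound is trivial.
  · rcases k with _ | k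
    · simp only [Finset.univ_eq_empty, Finset.sum_empty]
      positivity
    obtain ⟨w, hw, hx⟩ := exists_unit_smul x
    obtain ⟨l, hl⟩ := exists_ballChoice hw
    have h1 := pow_le_pow_left₀ (apply_nonneg _ _)
      (seqNorm_coord_le_seqNorm (fun i => ballEmbedding Z (f i)) (l, k)) 2
    rw [seqNorm_hilbert, Real.sq_sqrt (by positivity)] at h1
    simp only [EuclideanSpace.norm_sq_eq, coord_ballEmbedding, hl] at h1
    have h2 : ∀ j i, ‖(f i).1 (x j)‖ ^ 2 = ‖(f i).1 (w j)‖ ^ 2 * seqNorm (k + 1) x ^ 2 := by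
      intro j i
      have hj : x j = ((seqNorm (k + 1) x : ℝ) : ℂ) • w j := congrFun hx j
      conv_lhs => rw [hj]
      rw [map_smul, smul_eq_mul, norm_mul, Complex.norm_real,
        Real.norm_of_nonneg (apply_nonneg _ _)]
      ring
    simp only [h2, ← Finset.sum_mul]
    rw [Finset.sum_comm]
    exact mul_le_mul_of_nonneg_right h1 (sq_nonneg _)

/-- Boundedness of `g` comes for free: each `z` is `norm1 z` times an element whose value under `g`
is a coordinate of `y`, and a level-one bound is a sequential bound. -/
theorem mem_range_ballEmbedding {y : SumL2Inf (BallChoice Z)} (g : Z →ₗ[ℂ] ℂ)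
    (h : ∀ p i, coord y p i = g ((p.1 p.2).1 i)) : y ∈ Set.range (ballEmbedding Z) := by
  have hg : IsSeqBounded g := by
    refine ⟨norm1 (E := SumL2Inf (BallChoice Z)) y, mem_seqBounds_of_norm_le (norm1_nonneg _) fun z => ?_⟩
    obtain ⟨l, hl⟩ := exists_ball_coordinate z
    conv_lhs => rw [hl]
    rw [map_smul, smul_eq_mul, norm_mul, Complex.norm_real, Real.norm_of_nonneg (norm1_nonneg z),
      mul_comm, ← h (l, 0)]
    exact mul_le_mul_of_nonneg_right
      ((PiLp.norm_apply_le (coord y (l, 0)) 0).trans (norm_coord_le y (l, 0))) (norm1_nonneg z)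
  refine ⟨⟨g, hg⟩, coord_ext fun p => ?_⟩
  ext i
  rw [coord_ballEmbedding, h]

theorem isClosed_range_ballEmbedding {P : Submodule ℂ (Family (BallChoice Z))}
    (h0 : finFamilies (BallChoice Z) ≤ P) :
    @IsClosed _ (sigmaTopology fun (a : (P : Set (Family (BallChoice Z))))
      (y : SumL2Inf (BallChoice Z)) => sumPairing a.1 y) (Set.range (ballEmbedding Z)) := by
  let t : TopologicalSpace (SumL2Inf (BallChoice Z)) :=
    sigmaTopology fun (a : (P : Set (Family (BallChoice Z))))
      (y : SumL2Inf (BallChoice Z)) => sumPairing a.1 y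
  have hc : ∀ p i, Continuous fun y : SumL2Inf (BallChoice Z) => coord y p i := fun p i => by
    have := continuous_sigmaTopology (fun (a : (P : Set (Family (BallChoice Z))))
      (y : SumL2Inf (BallChoice Z)) => sumPairing a.1 y)
      ⟨single p (EuclideanSpace.single i 1), h0 (single_mem p _)⟩
    simpa only [sumPairing_single_basis] using this
  choose l hl using exists_ball_coordinate (Z := Z)
  -- `T` recovers the only possible functional from the coordinates of `y`, continuously for
  -- pointwise convergence on `Z`.
  let T : SumL2Inf (BallChoice Z) → Z → ℂ := fun y z => norm1 z * coord y (l z, 0) 0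
  have hT : Continuous T := continuous_pi fun z => continuous_const.mul (hc _ _)
  -- An element lies in the range exactly when the recovered function is linear and reproduces every
  -- coordinate; both conditions are closed.
  have hE : Set.range (ballEmbedding Z) =
      T ⁻¹' Set.range ((↑) : (Z →ₗ[ℂ] ℂ) → Z → ℂ) ∩
        ⋂ p, ⋂ i, {y | coord y p i = T y ((p.1 p.2).1 i)} := by
    ext y
    simp only [Set.mem_inter_iff, Set.mem_preimage, Set.mem_iInter, Set.mem_ofPred_eq]
    constructor
    · rintro ⟨f, rfl⟩
      have hf : T (ballEmbedding Z f) = f.1 := by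
        ext z
        conv_rhs => rw [hl z]
        rw [map_smul]
        rfl
      exact ⟨⟨f.1, hf.symm⟩, fun p i => by rw [hf]; rfl⟩
    · rintro ⟨⟨g, hg⟩, h⟩
      exact mem_range_ballEmbedding g fun p i => by rw [h, ← hg]
  rw [hE]
  refine ((LinearMap.isClosed_range_coe Z ℂ (RingHom.id ℂ)).preimage hT).inter
    (isClosed_iInter fun p => isClosed_iInter fun i => ?_)
  exact isClosed_eq (hc p i) ((continuous_apply _).comp hT)

/-- Points of `Z` always come from one-coordinate families. Conversely, `hP` prevents `P` from
inducing functionals that no point of `Z` gives. -/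
theorem dualWeakStar_eq_induced_ballEmbedding {P : Submodule ℂ (Family (BallChoice Z))}
    (h0 : finFamilies (BallChoice Z) ≤ P)
    (hP : ∀ a ∈ P, ∃ z, ∀ f, sumPairing a (ballEmbedding Z f) = f.1 z) :
    dualWeakStar Z = TopologicalSpace.induced (ballEmbedding Z)
      (sigmaTopology fun (a : (P : Set (Family (BallChoice Z))))
        (y : SumL2Inf (BallChoice Z)) => sumPairing a.1 y) := by
  refine sigmaTopology_eq_induced _ _ _ (fun z => ?_) fun a => hP a.1 a.2
  obtain ⟨l, hl⟩ := exists_ball_coordinate z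
  refine ⟨⟨(norm1 z : ℂ) • single (l, 0) (EuclideanSpace.single 0 1),
    P.smul_mem _ (h0 (single_mem _ _))⟩, fun f => ?_⟩
  conv_lhs => rw [hl]
  rw [map_smul]
  simp only [← map_smul, sumPairing_single]
  simp [coord_ballEmbedding]

theorem ball_term_eq (f : SeqDual Z) (a : Family (BallChoice Z)) (p : BallChoice Z × ℕ) :
    ∑ i, a p i * coord (ballEmbedding Z f) p i = f.1 (∑ i, a p i • (p.1 p.2).1 i) := by
  simp [coord_ballEmbedding]

theorem exists_eq_apply_of_mem_finFamilies {a : Family (BallChoice Z)}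
    (ha : a ∈ finFamilies (BallChoice Z)) :
    ∃ z, ∀ f, sumPairing a (ballEmbedding Z f) = f.1 z := by
  have hfin : {p | a p ≠ 0}.Finite := ha
  refine ⟨∑ p ∈ hfin.toFinset, ∑ i, a p i • (p.1 p.2).1 i, fun f => ?_⟩
  refine (hasSum_sumPairing (finFamilies_le ha) _).unique ?_
  simp only [ball_term_eq]
  rw [map_sum]
  refine hasSum_sum_of_ne_finset_zero fun p hp => ?_
  have : a p = 0 := by simpa using hp
  simp [this]

/-- The point is the series of the `∑ i, a p i • zᵢ` with `z` in the unit ball. Its terms have norm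
at most `‖a p‖`, so completeness of `Z` makes it converge. -/
theorem exists_eq_apply_of_mem_sumFamilies (hZ : IsBanach Z) {a : Family (BallChoice Z)}
    (ha : a ∈ sumFamilies (BallChoice Z)) :
    ∃ z, ∀ f, sumPairing a (ballEmbedding Z f) = f.1 z := by
  let := norm1Group Z
  let := norm1Space Z
  have : CompleteSpace Z := (isBanach_iff_completeSpace Z).1 hZ
  have hs : Summable fun p => ∑ i, a p i • (p.1 p.2).1 i :=
    Summable.of_norm_bounded (g := fun p => ‖a p‖) ha fun p =>
      (norm1_sum_smul_le (a p) (p.1 p.2).1).trans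
        (mul_le_of_le_one_right (norm_nonneg _) (p.1 p.2).2)
  refine ⟨∑' p, ∑ i, a p i • (p.1 p.2).1 i, fun f => ?_⟩
  refine (hasSum_sumPairing ha _).unique ?_
  simp only [ball_term_eq]
  exact hs.hasSum.mapL (f.1.mkContinuous (norm1 f) (norm_apply_le f))

end Embedding

/-! ### The predual defined by an embedding with closed range -/

section Predual

variable {X : Type u} [AddCommGroup X] [Module ℂ X] [OperatorSequenceSpace X]
  {Λ : Type u} {φ : X →ₗ[ℂ] SumL2Inf Λ} (hφ : SeqIsometric (Y := SumL2Inf Λ) φ)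
  {P : Submodule ℂ (Family Λ)} (h0 : finFamilies Λ ≤ P) (h1 : P ≤ sumFamilies Λ)

include hφ in
theorem norm_sumPairing_comp_le {a : Family Λ} (ha : a ∈ sumFamilies Λ) (x : X) :
    ‖sumPairing a (φ x)‖ ≤ (∑' p, ‖a p‖) * norm1 x := by
  rw [← hφ.norm1_eq]
  exact norm_sumPairing_le ha _

/-- The functionals `x ↦ ⟨a, φ x⟩` on `X`, for `a ∈ P`. -/
noncomputable def restrictedPairing (hφ : SeqIsometric (Y := SumL2Inf Λ) φ)
    (h1 : P ≤ sumFamilies Λ) : P →ₗ[ℂ] SeqDual X :=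
  LinearMap.codRestrict (SeqDual X) ((LinearMap.lcomp ℂ ℂ φ).comp (pairing h1)) fun a =>
    ⟨_, mem_seqBounds_of_norm_le (tsum_nonneg fun _ => norm_nonneg _)
      (norm_sumPairing_comp_le hφ (h1 a.2))⟩

theorem norm1_restrictedPairing_le (a : P) :
    norm1 (restrictedPairing hφ h1 a) ≤ ∑' p, ‖a.1 p‖ :=
  norm1_seqDual_le (tsum_nonneg fun _ => norm_nonneg _) (norm_sumPairing_comp_le hφ (h1 a.2))

/-- The predual of `X` that `φ` and `P` give: a subspace of the sequential dual of `X`. -/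
def Predual (hφ : SeqIsometric (Y := SumL2Inf Λ) φ) (h1 : P ≤ sumFamilies Λ) : Type u :=
  LinearMap.range (restrictedPairing hφ h1)

noncomputable instance : AddCommGroup (Predual hφ h1) :=
  inferInstanceAs (AddCommGroup (LinearMap.range (restrictedPairing hφ h1)))

noncomputable instance : Module ℂ (Predual hφ h1) :=
  inferInstanceAs (Module ℂ (LinearMap.range (restrictedPairing hφ h1)))

noncomputable instance : OperatorSequenceSpace (Predual hφ h1) :=
  inferInstanceAs (OperatorSequenceSpace (LinearMap.range (restrictedPairing hφ h1)))

/-- The inclusion of the predual in the sequential dual. -/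
noncomputable def predualIncl : Predual hφ h1 →ₗ[ℂ] SeqDual X :=
  (LinearMap.range (restrictedPairing hφ h1)).subtype

/-- The element of the predual that a family defines. -/
noncomputable def predualMk : P →ₗ[ℂ] Predual hφ h1 :=
  (restrictedPairing hφ h1).rangeRestrict

theorem predualMk_surjective : Function.Surjective (predualMk hφ h1) :=
  LinearMap.surjective_rangeRestrict _

theorem predualMk_eq_zero {a : P} : predualMk hφ h1 a = 0 ↔ restrictedPairing hφ h1 a = 0 :=
  Subtype.ext_iff

theorem predualIncl_seqIsometric : SeqIsometric (predualIncl hφ h1) := fun _ _ => rfl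

/-- The evaluation functionals on the predual. -/
noncomputable def predualEval : X →ₗ[ℂ] SeqDual (Predual hφ h1) where
  toFun x := ⟨(LinearMap.applyₗ x).comp ((SeqDual X).subtype.comp (predualIncl hφ h1)),
    norm1 x, mem_seqBounds_of_norm_le (norm1_nonneg x) fun z =>
      (norm_apply_le (predualIncl hφ h1 z) x).trans (le_of_eq (mul_comm _ _))⟩
  map_add' x y := Subtype.ext (LinearMap.ext fun z => map_add (predualIncl hφ h1 z).1 x y)
  map_smul' c x := Subtype.ext (LinearMap.ext fun z => map_smul (predualIncl hφ h1 z).1 c x)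

theorem predualEval_apply (x : X) (z : Predual hφ h1) :
    (predualEval hφ h1 x).1 z = (predualIncl hφ h1 z).1 x := rfl

include h0 in
theorem predualEval_seqIsometric : SeqIsometric (predualEval hφ h1) := by
  intro n x
  refine le_antisymm (dualSeminorm_le _ (apply_nonneg _ _) fun k z => ?_) ?_
  -- The double sum of `|z_l (x_i)|²` is symmetric in the two tuples, so the dual norm of `z`
  -- evaluated at `x` bounds it.
  · rw [mul_comm, Finset.sum_comm]
    exact dualSeminorm_bound (fun l => predualIncl hφ h1 (z l)) x
  · rw [← hφ n x]
    refine seqNorm_le_of_coord (apply_nonneg _ _) fun p => ?_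
    rw [seqNorm_hilbert]
    refine Real.sqrt_le_iff.2 ⟨apply_nonneg _ _, ?_⟩
    -- The functionals `x ↦ coord (φ x) p i` form a tuple in the unit ball, because `φ` followed by
    -- a coordinate is sequentially contractive. Testing on it recovers the norm of the coordinate
    -- `p`.
    let z : Fin (p.2 + 1) → Predual hφ h1 := fun i =>
      predualMk hφ h1 ⟨single p (EuclideanSpace.single i 1), h0 (single_mem p _)⟩
    have hz : ∀ i x, (predualIncl hφ h1 (z i)).1 x = coord (φ x) p i := fun i x => sumPairing_single_basis p i (φ x)
    have hz1 : seqNorm (p.2 + 1) z ≤ 1 := by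
      rw [← predualIncl_seqIsometric hφ h1]
      refine dualSeminorm_le _ zero_le_one fun k x => ?_
      simp only [hz]
      rw [one_pow, one_mul, ← hφ k x]
      have := pow_le_pow_left₀ (apply_nonneg _ _)
        (seqNorm_coord_le_seqNorm (fun i => φ (x i)) p) 2
      rw [seqNorm_hilbert, Real.sq_sqrt (by positivity)] at this
      simpa only [EuclideanSpace.norm_sq_eq] using this
    have h2 := (dualSeminorm_bound (fun i => predualEval hφ h1 (x i)) z).trans
      (mul_le_of_le_one_right (sq_nonneg _) (pow_le_one₀ (apply_nonneg _ _) hz1))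
    simp only [predualEval_apply, hz] at h2
    rw [Finset.sum_comm] at h2
    simp only [EuclideanSpace.norm_sq_eq]
    exact h2

variable (hcl : @IsClosed (SumL2Inf Λ) (sigmaTopology fun (a : (P : Set (Family Λ)))
  (y : SumL2Inf Λ) => sumPairing a.1 y) (Set.range φ))

include h0 hcl in
/-- Functionals on `P` that are bounded and vanish where `X` does are given by elements of `X`. -/
theorem exists_eq_restrictedPairing (G : P →ₗ[ℂ] ℂ) {C : ℝ} (hC : 0 ≤ C)
    (hG : ∀ a, ‖G a‖ ≤ C * ∑' p, ‖a.1 p‖) (hG0 : ∀ a, restrictedPairing hφ h1 a = 0 → G a = 0) :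
    ∃ x : X, norm1 x ≤ C ∧ ∀ a, G a = (restrictedPairing hφ h1 a).1 x := by
  obtain ⟨y, hyC, hy⟩ := exists_eq_sumPairing h0 h1 G hC hG
  -- Otherwise closedness gives `a ∈ P` that annihilates `range φ` but not `y`. It defines the zero
  -- functional on `X`, so `hG0` gives `G a = 0`, although `G a = ⟨a, y⟩`.
  have hyr : y ∈ LinearMap.range φ := by
    by_contra hn
    obtain ⟨a, ha, hay⟩ := exists_pairing_ne_zero (F := SumL2Inf Λ) (pairing h1)
      (LinearMap.range φ) (by
        rw [LinearMap.coe_range]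
        exact hcl) hn
    refine hay ?_
    rw [pairing_apply, ← hy]
    exact hG0 a (Subtype.ext (LinearMap.ext fun x => ha (φ x) ⟨x, rfl⟩))
  obtain ⟨x, rfl⟩ := hyr
  exact ⟨x, (hφ.norm1_eq x).symm.le.trans hyC, hy⟩

include h0 hcl in
theorem predualEval_surjective : Function.Surjective (predualEval hφ h1) := by
  intro f
  obtain ⟨x, -, hx⟩ := exists_eq_restrictedPairing hφ h0 h1 hcl (f.1.comp (predualMk hφ h1))
    (norm1_nonneg f)
    (fun a => (norm_apply_le f (predualMk hφ h1 a)).trans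
      (mul_le_mul_of_nonneg_left (norm1_restrictedPairing_le hφ h1 a) (norm1_nonneg f)))
    (fun a ha => by
      rw [LinearMap.comp_apply, (predualMk_eq_zero hφ h1).2 ha, map_zero])
  refine ⟨x, Subtype.ext (LinearMap.ext fun z => ?_)⟩
  obtain ⟨a, rfl⟩ := predualMk_surjective hφ h1 z
  exact (hx a).symm

/-- The identification of `X` with the sequential dual of its predual. -/
noncomputable def predualEquiv : X ≃ₗ[ℂ] SeqDual (Predual hφ h1) :=
  LinearEquiv.ofBijective (predualEval hφ h1)
    ⟨(predualEval_seqIsometric hφ h0 h1).injective, predualEval_surjective hφ h0 h1 hcl⟩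

end Predual

/-! ### The weak* topology given by the constructed predual -/

section WeakStar

variable {X : Type u} [AddCommGroup X] [Module ℂ X] [OperatorSequenceSpace X]
  {Λ : Type u} {φ : X →ₗ[ℂ] SumL2Inf Λ} (hφ : SeqIsometric (Y := SumL2Inf Λ) φ)
  {P : Submodule ℂ (Family Λ)} (h1 : P ≤ sumFamilies Λ)

theorem induced_predualEval :
    TopologicalSpace.induced (predualEval hφ h1) (dualWeakStar (Predual hφ h1)) =
      TopologicalSpace.induced φ (sigmaTopology fun (a : (P : Set (Family Λ))) (y : SumL2Inf Λ) =>
        sumPairing a.1 y) := by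
  have h : sigmaTopology (fun (a : P) (x : X) => sumPairing a.1 (φ x)) =
      TopologicalSpace.induced (predualEval hφ h1) (dualWeakStar (Predual hφ h1)) := by
    refine sigmaTopology_eq_induced _ _ _ (fun a => ⟨predualMk hφ h1 a, fun x => rfl⟩) fun z => ?_
    obtain ⟨a, rfl⟩ := predualMk_surjective hφ h1 z
    exact ⟨a, fun x => rfl⟩
  rw [← h]
  exact sigmaTopology_eq_induced _ _ _ (fun a => ⟨a, fun _ => rfl⟩) fun a => ⟨a, fun _ => rfl⟩

end WeakStar

/-! ### Completeness of the predual built from summable families -/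

section Complete

variable {X : Type u} [AddCommGroup X] [Module ℂ X] [OperatorSequenceSpace X]
  {Λ : Type u} {φ : X →ₗ[ℂ] SumL2Inf Λ} (hφ : SeqIsometric (Y := SumL2Inf Λ) φ)

/-- The Banach space of absolutely summable families. -/
abbrev FamilyL1 (Λ : Type u) : Type u :=
  lp (fun p : Λ × ℕ => EuclideanSpace ℂ (Fin (p.2 + 1))) 1

theorem mem_sumFamilies_iff {a : Family Λ} : a ∈ sumFamilies Λ ↔ Memℓp a 1 := by
  rw [memℓp_gen_iff (by simp)]
  simp only [ENNReal.toReal_one, Real.rpow_one]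
  rfl

theorem norm_familyL1 (a : FamilyL1 Λ) : ‖a‖ = ∑' p, ‖a p‖ := by
  rw [lp.norm_eq_tsum_rpow (by simp)]
  simp

/-- The Banach space of absolutely summable families consists of these families. -/
def familyL1Equiv (Λ : Type u) : FamilyL1 Λ ≃ₗ[ℂ] sumFamilies Λ where
  toFun a := ⟨fun p => a p, mem_sumFamilies_iff.2 (lp.memℓp a)⟩
  invFun a := ⟨a.1, mem_sumFamilies_iff.1 a.2⟩
  left_inv _ := rfl
  right_inv _ := rfl
  map_add' _ _ := rfl
  map_smul' _ _ := rfl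

/-- The norm inherited from `X^△` is at most the quotient norm of `ℓ¹` by the kernel `N`. They are
equal because functionals in the unit ball of the dual of `ℓ¹ / N` are evaluations at points of the
unit ball of `X`. -/
theorem isBanach_predual (hcl : @IsClosed (SumL2Inf Λ) (sumBanachWeakStar Λ) (Set.range φ)) :
    IsBanach (Predual hφ (le_refl (sumFamilies Λ))) := by
  let := norm1Group (Predual hφ (le_refl (sumFamilies Λ)))
  let := norm1Space (Predual hφ (le_refl (sumFamilies Λ)))
  rw [isBanach_iff_completeSpace]
  let Q : FamilyL1 Λ →ₗ[ℂ] Predual hφ (le_refl (sumFamilies Λ)) :=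
    (predualMk hφ le_rfl).comp (familyL1Equiv Λ).toLinearMap
  have hQ1 : ∀ a, ‖Q a‖ ≤ 1 * ‖a‖ := fun a => by
    rw [norm_familyL1, one_mul]
    exact norm1_restrictedPairing_le hφ le_rfl (familyL1Equiv Λ a)
  let Qc : FamilyL1 Λ →L[ℂ] Predual hφ (le_refl (sumFamilies Λ)) := Q.mkContinuous 1 hQ1
  have hQs : Function.Surjective Q :=
    (predualMk_surjective hφ le_rfl).comp (familyL1Equiv Λ).surjective
  let N : Submodule ℂ (FamilyL1 Λ) := LinearMap.ker Q
  have : IsClosed (N : Set (FamilyL1 Λ)) := ContinuousLinearMap.isClosed_ker Qc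
  let e : (FamilyL1 Λ ⧸ N) ≃ₗ[ℂ] Predual hφ (le_refl (sumFamilies Λ)) :=
    Q.quotKerEquivOfSurjective hQs
  have he : ∀ a, e (N.mkQ a) = Q a := fun a => rfl
  have hle : ∀ v, ‖v‖ ≤ 1 * ‖e v‖ := by
    intro v
    obtain ⟨a, rfl⟩ := N.mkQ_surjective v
    -- A Hahn–Banach functional norming the class of `a`; its pullback to families is evaluation at
    -- some `x` with `norm1 x ≤ 1`.
    obtain ⟨g, hg1, hg⟩ := exists_dual_vector'' ℂ (N.mkQ a)
    let G : sumFamilies Λ →ₗ[ℂ] ℂ :=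
      g.toLinearMap.comp (N.mkQ.comp (familyL1Equiv Λ).symm.toLinearMap)
    obtain ⟨x, hx1, hx⟩ := exists_eq_restrictedPairing hφ finFamilies_le le_rfl hcl G zero_le_one
      (fun b => by
        have hb := g.le_of_opNorm_le_of_le hg1
          (Submodule.Quotient.norm_mk_le (S := N) ((familyL1Equiv Λ).symm b))
        rw [norm_familyL1] at hb
        exact hb)
      (fun b hb => by
        have : N.mkQ ((familyL1Equiv Λ).symm b) = 0 := by
          rw [Submodule.mkQ_apply, Submodule.Quotient.mk_eq_zero]
          exact (predualMk_eq_zero hφ le_rfl).2 hb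
        change g (N.mkQ ((familyL1Equiv Λ).symm b)) = 0
        rw [this, map_zero])
    have h2 : g (N.mkQ a) = (predualIncl hφ le_rfl (Q a)).1 x := hx (familyL1Equiv Λ a)
    rw [one_mul, he]
    calc ‖N.mkQ a‖ = ‖(predualIncl hφ le_rfl (Q a)).1 x‖ := by
          rw [← h2, hg]; simp
      _ ≤ norm1 (predualIncl hφ le_rfl (Q a)) * norm1 x := norm_apply_le _ _
      _ ≤ norm1 (predualIncl hφ le_rfl (Q a)) := mul_le_of_le_one_right (norm1_nonneg _) hx1
  have hge : ∀ v, ‖e v‖ ≤ 1 * ‖v‖ := by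
    intro v
    obtain ⟨a, rfl⟩ := N.mkQ_surjective v
    refine le_of_forall_pos_le_add fun ε hε => ?_
    -- A representative of the class whose norm exceeds the quotient norm by less than `ε`.
    obtain ⟨b, hb, hbn⟩ := Submodule.Quotient.norm_mk_lt (N.mkQ a) hε
    rw [← hb, one_mul]
    have := hQ1 b
    rw [one_mul] at this
    rw [hb]
    refine le_trans ?_ hbn.le
    rw [← hb]
    exact this
  have hei : ∀ v, ‖e v‖ = ‖v‖ := fun v =>
    le_antisymm ((hge v).trans (one_mul _).le) ((hle v).trans (one_mul _).le)
  exact (LinearIsometryEquiv.mk e hei).toIsometryEquiv.completeSpace_iff.1 inferInstance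

end Complete

/-! ### The equivalences for both kinds of preduals -/

variable (X : Type u) [AddCommGroup X] [Module ℂ X] [OperatorSequenceSpace X]

theorem isEmbedding_iff_eq_induced {A B : Type*} {τ : TopologicalSpace A} {t : TopologicalSpace B}
    {f : A → B} (hf : Function.Injective f) : IsEmbedding f ↔ τ = t.induced f :=
  ⟨fun h => h.eq_induced, fun h => ⟨⟨h⟩, hf⟩⟩

theorem isDualOSS_iff_exists : IsDualOSS X ↔ ∃ τ, IsDualOSSWith X τ :=
  ⟨fun ⟨Z, _, _, _, j, hj⟩ => ⟨_, Z, _, _, _, j, hj, rfl⟩,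
    fun ⟨_, Z, _, _, _, j, hj, _⟩ => ⟨Z, _, _, _, j, hj⟩⟩

theorem isBanachDualOSS_iff_exists : IsBanachDualOSS X ↔ ∃ τ, IsBanachDualOSSWith X τ :=
  ⟨fun ⟨Z, _, _, _, j, hZ, hj⟩ => ⟨_, Z, _, _, _, j, hZ, hj, rfl⟩,
    fun ⟨_, Z, _, _, _, j, hZ, hj, _⟩ => ⟨Z, _, _, _, j, hZ, hj⟩⟩

variable {X}

/-- A dual space embeds in a sum of copies of `l₂^∞`, given that the families in `P` define
elements of the predual. -/
theorem exists_embedding {Z : Type u} [AddCommGroup Z] [Module ℂ Z] [OperatorSequenceSpace Z]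
    (j : X ≃ₗ[ℂ] SeqDual Z) (hj : SeqIsometric (j : X →ₗ[ℂ] SeqDual Z))
    {P : Submodule ℂ (Family (BallChoice Z))} (h0 : finFamilies (BallChoice Z) ≤ P)
    (hP : ∀ a ∈ P, ∃ z, ∀ f, sumPairing a (ballEmbedding Z f) = f.1 z) :
    ∃ φ : X →ₗ[ℂ] SumL2Inf (BallChoice Z), SeqIsometric (Y := SumL2Inf (BallChoice Z)) φ ∧
      @IsClosed _ (sigmaTopology fun (a : (P : Set (Family (BallChoice Z))))
        (y : SumL2Inf (BallChoice Z)) => sumPairing a.1 y) (Set.range φ) ∧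
      @IsEmbedding X _ (TopologicalSpace.induced j (dualWeakStar Z))
        (sigmaTopology fun (a : (P : Set (Family (BallChoice Z))))
          (y : SumL2Inf (BallChoice Z)) => sumPairing a.1 y) φ := by
  have hφ : SeqIsometric (Y := SumL2Inf (BallChoice Z))
      ((ballEmbedding Z).comp (j : X →ₗ[ℂ] SeqDual Z)) := fun n x =>
    (ballEmbedding_seqIsometric n fun i => j (x i)).trans (hj n x)
  have hr : Set.range ((ballEmbedding Z).comp (j : X →ₗ[ℂ] SeqDual Z))
      = Set.range (ballEmbedding Z) := by
    rw [LinearMap.coe_comp]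
    exact j.surjective.range_comp _
  refine ⟨_, hφ, ?_, ?_⟩
  · rw [hr]
    exact isClosed_range_ballEmbedding h0
  · rw [isEmbedding_iff_eq_induced hφ.injective, dualWeakStar_eq_induced_ballEmbedding h0 hP, induced_compose]
    rfl

theorem isDualOSSWith_iff (τ : TopologicalSpace X) : IsDualOSSWith X τ ↔
    ∃ (Λ : Type u) (φ : X →ₗ[ℂ] SumL2Inf Λ), SeqIsometric (Y := SumL2Inf Λ) φ ∧
      @IsClosed (SumL2Inf Λ) (sumWeakStar Λ) (Set.range φ) ∧
      @IsEmbedding X (SumL2Inf Λ) τ (sumWeakStar Λ) φ := by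
  constructor
  · rintro ⟨Z, _, _, _, j, hj, rfl⟩
    exact ⟨BallChoice Z, exists_embedding j hj (le_refl (finFamilies (BallChoice Z)))
      fun a ha => exists_eq_apply_of_mem_finFamilies ha⟩
  · rintro ⟨Λ, φ, hφ, hcl, he⟩
    refine ⟨Predual hφ finFamilies_le, _, _, _, predualEquiv hφ le_rfl finFamilies_le hcl,
      predualEval_seqIsometric hφ le_rfl finFamilies_le, ?_⟩
    exact ((isEmbedding_iff_eq_induced hφ.injective).1 he).trans (induced_predualEval hφ finFamilies_le).symm

theorem isBanachDualOSSWith_iff (τ : TopologicalSpace X) : IsBanachDualOSSWith X τ ↔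
    ∃ (Λ : Type u) (φ : X →ₗ[ℂ] SumL2Inf Λ), SeqIsometric (Y := SumL2Inf Λ) φ ∧
      @IsClosed (SumL2Inf Λ) (sumBanachWeakStar Λ) (Set.range φ) ∧
      @IsEmbedding X (SumL2Inf Λ) τ (sumBanachWeakStar Λ) φ := by
  constructor
  · rintro ⟨Z, _, _, _, j, hZ, hj, rfl⟩
    exact ⟨BallChoice Z, exists_embedding j hj (finFamilies_le (Λ := BallChoice Z))
      fun a ha => exists_eq_apply_of_mem_sumFamilies hZ ha⟩
  · rintro ⟨Λ, φ, hφ, hcl, he⟩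
    refine ⟨Predual hφ (le_refl (sumFamilies Λ)), _, _, _,
      predualEquiv hφ finFamilies_le le_rfl hcl, isBanach_predual hφ hcl,
      predualEval_seqIsometric hφ finFamilies_le le_rfl, ?_⟩
    exact ((isEmbedding_iff_eq_induced hφ.injective).1 he).trans (induced_predualEval hφ le_rfl).symm

end OpSeq

theorem mainTheorem10 (X : Type u) [AddCommGroup X] [Module ℂ X]
    [OpSeq.OperatorSequenceSpace X] :
    (OpSeq.IsDualOSS X ↔
      ∃ (Λ : Type u) (φ : X →ₗ[ℂ] OpSeq.SumL2Inf Λ), OpSeq.SeqIsometric (Y := OpSeq.SumL2Inf Λ) φ ∧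
        @IsClosed (OpSeq.SumL2Inf Λ) (OpSeq.sumWeakStar Λ) (Set.range φ)) ∧
    (∀ τ : TopologicalSpace X, OpSeq.IsDualOSSWith X τ ↔
      ∃ (Λ : Type u) (φ : X →ₗ[ℂ] OpSeq.SumL2Inf Λ), OpSeq.SeqIsometric (Y := OpSeq.SumL2Inf Λ) φ ∧
        @IsClosed (OpSeq.SumL2Inf Λ) (OpSeq.sumWeakStar Λ) (Set.range φ) ∧
        @Topology.IsEmbedding X (OpSeq.SumL2Inf Λ) τ (OpSeq.sumWeakStar Λ) φ) ∧
    (OpSeq.IsBanachDualOSS X ↔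
      ∃ (Λ : Type u) (φ : X →ₗ[ℂ] OpSeq.SumL2Inf Λ), OpSeq.SeqIsometric (Y := OpSeq.SumL2Inf Λ) φ ∧
        @IsClosed (OpSeq.SumL2Inf Λ) (OpSeq.sumBanachWeakStar Λ) (Set.range φ)) ∧
    (∀ τ : TopologicalSpace X, OpSeq.IsBanachDualOSSWith X τ ↔
      ∃ (Λ : Type u) (φ : X →ₗ[ℂ] OpSeq.SumL2Inf Λ), OpSeq.SeqIsometric (Y := OpSeq.SumL2Inf Λ) φ ∧
        @IsClosed (OpSeq.SumL2Inf Λ) (OpSeq.sumBanachWeakStar Λ) (Set.range φ) ∧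
        @Topology.IsEmbedding X (OpSeq.SumL2Inf Λ) τ (OpSeq.sumBanachWeakStar Λ) φ) := by

  refine ⟨?_, OpSeq.isDualOSSWith_iff, ?_, OpSeq.isBanachDualOSSWith_iff⟩
  · rw [OpSeq.isDualOSS_iff_exists]
    simp only [OpSeq.isDualOSSWith_iff]
    -- When no topology is prescribed, the one induced by `φ` makes the injective map `φ` an
    -- embedding, so the version with a topology applies.
    exact ⟨fun ⟨_, Λ, φ, hφ, hcl, _⟩ => ⟨Λ, φ, hφ, hcl⟩,
      fun ⟨Λ, φ, hφ, hcl⟩ => ⟨_, Λ, φ, hφ, hcl, (OpSeq.isEmbedding_iff_eq_induced hφ.injective).2 rfl⟩⟩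
  · rw [OpSeq.isBanachDualOSS_iff_exists]
    simp only [OpSeq.isBanachDualOSSWith_iff]
    exact ⟨fun ⟨_, Λ, φ, hφ, hcl, _⟩ => ⟨Λ, φ, hφ, hcl⟩,
      fun ⟨Λ, φ, hφ, hcl⟩ => ⟨_, Λ, φ, hφ, hcl, (OpSeq.isEmbedding_iff_eq_induced hφ.injective).2 rfl⟩⟩
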